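/- Let $0<p<1$ and $q=1-p$. Label the edges of the nearest-neighbour lattice on the first quadrant $\{0,1,2,\dots\}^2$ with $0$ and $1$ as follows. The edges of the $x$-axis are labelled $1$ with probability $p$ and $0$ with probability $q$, the edges of the $y$-axis are labelled $1$ with probability $q$ and $0$ with probability $p$, all independently. Then the horizontal strips $[0,\infty)\times[y,y+1]$, $y=0,1,2,\dots$, are filled one after the other, each from left to right, square by square: when the lower label $e$ and the left label $l$ of a unit square are known, its upper label $u$ and right label $r$ are chosen such that $e+r=l+u$; if there are two possibilities (that is, if $e=l$, and then $u=r\in\{0,1\}$), one of them is chosen with probability $\tfrac12$ each, independently of everything else. Let $\nu$ be the law of the resulting labelling of the quadrant. Then: 1. Under $\nu$, for every $y\ge 0$ the labels of the upper edges of the strip $[0,\infty)\times[y,y+1]$ are again i.i.d., equal to $1$ with probability $p$; and for every $x\ge 0$ the labels of the right edges of the strip $[x,x+1]\times[0,\infty)$ are i.i.d., equal to $1$ with probability $q$. 2. There is exactly one measure $\mu$ on $\{0,1\}$-labellings of the edges of $\mathbb{Z}^2$ (with the product $\sigma$-algebra) under which, for every $z\in\mathbb{Z}^2$, the labelling of the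 quadrant $z+[0,\infty)^2$ has law $\nu$ (after translating $z$ to the origin). It is a probability measure, and $\mu$-almost every labelling is a cocycle, i.e. $e+r=l+u$ holds for the lower, right, left and upper labels of every unit square. 3. Let $T_z$, $z\in\mathbb{Z}^2$, be the translations of labellings, $(T_z\omega)(b)=\omega(b+z)$ for every edge $b$. The measure $\mu$ is stationary, i.e. invariant under all $T_z$, and mixing: for all measurable sets $A,B$ of labellings, $$\mu\bigl(A\cap T_z^{-1}B\bigr)\longrightarrow\mu(A)\,\mu(B)\qquad\text{as } z\to\infty \text{ in } \mathbb{Z}^2 .$$ In particular $\mu$ is ergodic: every measurable set $A$ with $\mu(A\,\triangle\,T_z^{-1}A)=0$ for all $z\in\mathbb{Z}^2$ has $\mu(A)\in\{0,1\}$. -/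

import Mathlib

namespace CocycleMeasure

open MeasureTheory ProbabilityTheory Filter Topology

/-- Nearest-neighbour edges of a square lattice whose vertices have coordinates in `ι` (`ι = ℤ` for
the whole plane, `ι = ℕ` for the closed first quadrant), indexed by their lower left endpoint:
`hor x y` joins `(x, y)` to `(x + 1, y)` and `ver x y` joins `(x, y)` to `(x, y + 1)`. -/
inductive Edge (ι : Type) : Type
  | hor (x y : ι) : Edge ι
  | ver (x y : ι) : Edge ι

/-- Labellings of the edges by 0 (`false`) and 1 (`true`), with the product σ-algebra. -/
abbrev Labelling (ι : Type) : Type := Edge ι → Bool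

/-- The cocycle property of a square: the sum of the labels of the lower and the right edge equals
the sum of the labels of the left and the upper edge. -/
def SquareCocycle (lower left upper right : Bool) : Prop :=
  lower.toNat + right.toNat = left.toNat + upper.toNat

/-- A labelling of the plane has the cocycle property if all unit squares do. -/
def IsCocycle (ω : Labelling ℤ) : Prop :=
  ∀ x y : ℤ, SquareCocycle (ω (.hor x y)) (ω (.ver x y)) (ω (.hor x (y + 1))) (ω (.ver (x + 1) y))

/-! ### Completing a square and filling the quadrant

Given the lower and the left label, the square has one completion if they differ (upper = lower,
right = left), and two if they agree (upper = right, of either value). In the second case the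
completion is chosen by a coin `c`. -/

/-- The label given to the upper edge of a square. -/
def fillUpper (lower left c : Bool) : Bool := if lower = left then c else lower

/-- The label given to the right edge of a square. -/
def fillRight (lower left c : Bool) : Bool := if lower = left then c else left

/-- The possible completions are exactly those given by the two values of the coin. -/
theorem squareCocycle_iff (lower left upper right : Bool) :
    SquareCocycle lower left upper right ↔
      ∃ c, upper = fillUpper lower left c ∧ right = fillRight lower left c := by
  cases lower <;> cases left <;> cases upper <;> cases right <;>
    simp [SquareCocycle, fillUpper, fillRight]

/-- If the lower and left labels agree, then the two coin values give different completions. -/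
theorem fill_ne (a : Bool) :
    fillUpper a a false ≠ fillUpper a a true ∧ fillRight a a false ≠ fillRight a a true := by
  simp [fillUpper, fillRight]

/-- Labels of the vertical edges of a horizontal strip, filled from left to right: `lower n` is the
label of the lower edge of the `n`-th square, `left` the label of the leftmost vertical edge and
`c n` the coin used at the `n`-th square. -/
def stripVer (lower : ℕ → Bool) (left : Bool) (c : ℕ → Bool) : ℕ → Bool
  | 0 => left
  | n + 1 => fillRight (lower n) (stripVer lower left c n) (c n)

/-- Labels of the upper edges of a horizontal strip, filled from left to right. -/
def stripUpper (lower : ℕ → Bool) (left : Bool) (c : ℕ → Bool) (n : ℕ) : Bool :=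
  fillUpper (lower n) (stripVer lower left c n) (c n)

/-- Labels of the horizontal edges of the quadrant at height `0, 1, 2, …`, filled strip by strip from
the labels `a` of the x-axis, the labels `b` of the y-axis and the coins `c`. -/
def rowHor (a b : ℕ → Bool) (c : ℕ × ℕ → Bool) : ℕ → ℕ → Bool
  | 0 => a
  | y + 1 => stripUpper (rowHor a b c y) (b y) (fun x => c (x, y))

/-- The randomness of the procedure: labels of the x-axis, labels of the y-axis, and one coin for
each unit square of the quadrant (`(x, y)` being its lower left corner). -/
abbrev Seed : Type := (ℕ → Bool) × (ℕ → Bool) × (ℕ × ℕ → Bool)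

/-- The labelling of the quadrant produced by the procedure. -/
def fillQuadrant (s : Seed) : Labelling ℕ
  | .hor x y => rowHor s.1 s.2.1 s.2.2 y x
  | .ver x y => stripVer (rowHor s.1 s.2.1 s.2.2 y) (s.2.1 y) (fun x' => s.2.2 (x', y)) x

/-- The law of a label that is 1 with probability `p` and 0 with probability `1 - p`. -/
noncomputable def labelLaw (p : unitInterval) : Measure Bool := bernoulliMeasure true false p

/-- The law of a fair coin. -/
noncomputable def coinLaw : Measure Bool := labelLaw ⟨1 / 2, by norm_num, by norm_num⟩

/-- All seeds are independent; labels on the x-axis are 1 with probability `p`, labels on the y-axis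
are 1 with probability `1 - p`, coins are fair. -/
noncomputable def seedLaw (p : unitInterval) : Measure Seed :=
  (Measure.infinitePi fun _ : ℕ => labelLaw p).prod
    ((Measure.infinitePi fun _ : ℕ => labelLaw (unitInterval.symm p)).prod
      (Measure.infinitePi fun _ : ℕ × ℕ => coinLaw))

/-- The law of the labelling of the first quadrant. -/
noncomputable def quadrantLaw (p : unitInterval) : Measure (Labelling ℕ) :=
  (seedLaw p).map fillQuadrant

/-! ### The whole plane -/

/-- The quadrant with corner `z`, as a set of edges of the plane. -/
def Edge.toPlane (z : ℤ × ℤ) : Edge ℕ → Edge ℤ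
  | .hor x y => .hor (z.1 + x) (z.2 + y)
  | .ver x y => .ver (z.1 + x) (z.2 + y)

/-- The labelling of the quadrant with corner `z` cut out of a labelling of the plane. -/
def restrictQuadrant (z : ℤ × ℤ) (ω : Labelling ℤ) : Labelling ℕ := fun e => ω (e.toPlane z)

/-- `μ` extends the law of the procedure to the plane: every quadrant `z + [0, ∞)²` is labelled
according to the procedure. -/
def IsPlaneExtension (p : unitInterval) (μ : Measure (Labelling ℤ)) : Prop :=
  ∀ z : ℤ × ℤ, μ.map (restrictQuadrant z) = quadrantLaw p

/-- Translation of an edge over the vector `z`. -/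
def Edge.shift (z : ℤ × ℤ) : Edge ℤ → Edge ℤ
  | .hor x y => .hor (x + z.1) (y + z.2)
  | .ver x y => .ver (x + z.1) (y + z.2)

/-- The group `ℤ²` acts on labellings by translations, `(z +ᵥ ω) e = ω (e + z)`. -/
instance : AddAction (ℤ × ℤ) (Labelling ℤ) where
  vadd z ω := fun e => ω (e.shift z)
  zero_vadd ω := by
    funext e
    change ω (e.shift 0) = ω e
    cases e <;> simp [Edge.shift]
  add_vadd z w ω := by
    funext e
    change ω (e.shift (z + w)) = ω ((e.shift z).shift w)
    cases e <;> simp [Edge.shift, add_assoc]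

/-- `μ` is mixing under the translations of `ℤ²`: `μ (A ∩ T_z⁻¹ B) → μ A * μ B` as `z` tends to
infinity in `ℤ²`, in any direction. -/
def IsMixing (μ : Measure (Labelling ℤ)) : Prop :=
  ∀ A B : Set (Labelling ℤ), MeasurableSet A → MeasurableSet B →
    Tendsto (fun z : ℤ × ℤ => μ (A ∩ (fun ω => z +ᵥ ω) ⁻¹' B)) cofinite (𝓝 (μ A * μ B))

end CocycleMeasure

/-! The engine is a Burke-type property of a single square. To its upper and right labels add a
third bit, the freed coin: the lower label if it agrees with the left one, the unused coin
otherwise. The resulting map on three bits is an involution: the identity when lower and left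
differ, and the exchange of their common value with the coin when they agree. Both common values
have weight p(1-p), so the product law is preserved (`measurePreserving_squareUpdate`). Composing
over a rectangle (`measurePreserving_fillRect`), the labels on its outgoing sides, the remaining
axis labels and all freed or untouched coins again form an independent family with the original
laws. Hence every smaller quadrant is filled from seeds of the right law
(`measurePreserving_shiftConfig`), which gives the laws of rows and columns and the consistency of
the quadrant law. A limit point of copies of that law placed at (-n, -n) is a plane extension; it is
unique because finitely many edges always lie in one quadrant, and uniqueness gives stationarity.

For mixing, approximate by cylinder events and compare two distant boxes. If one is far to the
north-west of the other, fill the rectangle spanned between them: the boxes then use disjoint sets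
of independent bits, and the events are exactly independent (`real_inter_shift_eq_mul`). Otherwise
one box lies, up to bounded error, to the north-east of the other. Resample the seeds that determine
the event of the lower box; the other event changes only if a discrepancy reaches it. Outside the
resampled seeds, a single discrepancy entering a square leaves it through the upper or the right
edge, each with probability 1/2, while two entering ones both survive or both vanish. Discrepancy
probabilities are thus dominated by the visiting probabilities of a simple random walk started near
the corner (`discrepancy_add_le_choose`), which decay like the inverse square root of the distance.
Ergodicity follows by mixing an invariant event with itself. -/

namespace CocycleMeasure

open MeasureTheory ProbabilityTheory Filter Topology
open scoped symmDiff

/-! ### Measures on products of two-point spaces -/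

section ProductMeasures

variable {ι κ Ω : Type*} [MeasurableSpace Ω]

theorem ext_of_map_restrict {μ ν : Measure (ι → Bool)} [IsFiniteMeasure μ] [IsFiniteMeasure ν]
    (h : ∀ r : Finset ι, μ.map r.restrict = ν.map r.restrict) : μ = ν :=
  IsProjectiveLimit.unique (P := fun r : Finset ι => ν.map r.restrict) h fun _ => rfl

/-- A finite measure on `ι → Bool` is determined by its values on the cylinders over large
finite sets. -/
theorem ext_of_cylinders {μ ν : Measure (ι → Bool)} [IsFiniteMeasure μ] [IsFiniteMeasure ν]
    (s : Finset ι)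
    (h : ∀ r : Finset ι, s ⊆ r → ∀ v : ι → Bool,
      μ {ω | ∀ i ∈ r, ω i = v i} = ν {ω | ∀ i ∈ r, ω i = v i}) : μ = ν := by
  classical
  have key : ∀ r : Finset ι, s ⊆ r → μ.map r.restrict = ν.map r.restrict := by
    intro r hr
    refine Measure.ext_of_singleton fun a => ?_
    have hset : (r.restrict : (ι → Bool) → (r → Bool)) ⁻¹' {a} =
        {ω | ∀ i ∈ r, ω i = (fun i => if hi : i ∈ r then a ⟨i, hi⟩ else false) i} := by
      ext ω
      simp only [Set.mem_preimage, Set.mem_singleton_iff, Set.mem_ofPred_eq, funext_iff,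
        Subtype.forall, Finset.restrict]
      refine forall₂_congr fun i hi => ?_
      simp [hi]
    rw [Measure.map_apply (by fun_prop) (measurableSet_singleton a),
      Measure.map_apply (by fun_prop) (measurableSet_singleton a), hset, h r hr]
  refine ext_of_map_restrict fun r => ?_
  have hcomp : (r.restrict : (ι → Bool) → (r → Bool)) =
      Finset.restrict₂ (π := fun _ => Bool) (Finset.subset_union_left (s₂ := s)) ∘
        (r ∪ s).restrict := rfl
  rw [hcomp, ← Measure.map_map (by fun_prop) (by fun_prop),
    ← Measure.map_map (by fun_prop) (by fun_prop), key _ Finset.subset_union_right]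

/-- The comparison map `g` may vary with the finite set. This passes from finite rectangles to
infinite strips, where no single composition of square updates suffices. -/
theorem measurePreserving_of_locally {μ : Measure Ω} [IsFiniteMeasure μ] {ν : Measure (ι → Bool)}
    [IsFiniteMeasure ν] {f : Ω → ι → Bool} (hf : Measurable f)
    (h : ∀ r : Finset ι, ∃ g, MeasurePreserving g μ ν ∧ ∀ ω, ∀ i ∈ r, f ω i = g ω i) :
    MeasurePreserving f μ ν := by
  refine ⟨hf, ext_of_map_restrict fun r => ?_⟩
  obtain ⟨g, hg, hfg⟩ := h r
  rw [← hg.map_eq, Measure.map_map (by fun_prop) hf, Measure.map_map (by fun_prop) hg.measurable]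
  congr 1
  funext ω i
  exact hfg ω i i.2

theorem measurePreserving_reindex (m : κ → Measure Bool) [∀ j, IsProbabilityMeasure (m j)]
    {k : ι → κ} (hk : Function.Injective k) :
    MeasurePreserving (fun (ω : κ → Bool) i => ω (k i)) (Measure.infinitePi m)
      (Measure.infinitePi fun i => m (k i)) := by
  classical
  refine ⟨by fun_prop, Measure.eq_infinitePi _ fun s t ht => ?_⟩
  rw [Measure.map_apply (by fun_prop) (.pi s.countable_toSet fun i _ => ht i)]
  have hset : (fun (ω : κ → Bool) i => ω (k i)) ⁻¹' (s : Set ι).pi t =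
      (s.image k : Set κ).pi (Function.extend k t fun _ => Set.univ) := by
    ext ω
    simp [hk.extend_apply]
  rw [hset, Measure.infinitePi_pi _ fun j _ => MeasurableSet.of_discrete,
    Finset.prod_image fun a _ b _ h => hk h]
  simp [hk.extend_apply]

theorem measurableSet_iSup_comap_of_dependsOn {E : Set (ι → Bool)} {S : Set ι}
    (hE : MeasurableSet E) (hES : DependsOn (· ∈ E) S) :
    MeasurableSet[⨆ i ∈ S, MeasurableSpace.comap (fun ω : ι → Bool => ω i) inferInstance] E := by
  classical
  -- Overwriting the coordinates outside `S` by a constant does not affect membership in `E`, and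
  -- `g` is measurable for the coordinates in `S` alone.
  set g : (ι → Bool) → ι → Bool := fun ω i => if i ∈ S then ω i else false
  have hpre : g ⁻¹' E = E := by
    ext ω
    have := hES (x := g ω) (y := ω) fun i hi => by simp [g, hi]
    simpa using this
  rw [← hpre]
  suffices h : Measurable[⨆ i ∈ S, MeasurableSpace.comap (fun ω : ι → Bool => ω i) inferInstance] g
    from h hE
  refine @measurable_pi_lambda _ _ _ (_) _ _ fun i => ?_
  by_cases hi : i ∈ S
  · have : (fun ω => g ω i) = fun ω : ι → Bool => ω i := by simp [g, hi]
    rw [this]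
    exact Measurable.mono (comap_measurable _)
      (le_iSup₂ (f := fun i (_ : i ∈ S) => MeasurableSpace.comap (fun ω : ι → Bool => ω i)
        inferInstance) i hi) le_rfl
  · have : (fun ω => g ω i) = fun _ : ι → Bool => false := by simp [g, hi]
    rw [this]
    exact measurable_const

/-- Events depending on disjoint sets of coordinates are independent. -/
theorem infinitePi_inter_of_dependsOn (m : ι → Measure Bool) [∀ j, IsProbabilityMeasure (m j)]
    {E F : Set (ι → Bool)} {S T : Set ι} (hE : MeasurableSet E) (hF : MeasurableSet F)
    (hES : DependsOn (· ∈ E) S) (hFT : DependsOn (· ∈ F) T) (hST : Disjoint S T) :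
    Measure.infinitePi m (E ∩ F) = Measure.infinitePi m E * Measure.infinitePi m F := by
  have hind : iIndepFun (fun i (ω : ι → Bool) => ω i) (Measure.infinitePi m) :=
    iIndepFun_infinitePi (P := m) (X := fun _ b => b) fun _ => measurable_id
  exact (Indep_iff _ _ _).1 (indep_iSup_of_disjoint
    (fun i => (measurable_pi_apply i).comap_le) hind hST) E F
    (measurableSet_iSup_comap_of_dependsOn hE hES) (measurableSet_iSup_comap_of_dependsOn hF hFT)

end ProductMeasures

/-! ### The filling procedure on a single product space -/

/-- The indices of the random bits in a seed. -/
inductive SeedIndex : Type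
  | hor (x : ℕ)
  | ver (y : ℕ)
  | coin (x y : ℕ)

/-- Seeds, as functions on a single index type. -/
abbrev Config : Type := SeedIndex → Bool

def Config.toSeed (σ : Config) : Seed :=
  (fun x => σ (.hor x), fun y => σ (.ver y), fun z => σ (.coin z.1 z.2))

noncomputable def indexLaw (p : unitInterval) : SeedIndex → Measure Bool
  | .hor _ => labelLaw p
  | .ver _ => labelLaw (unitInterval.symm p)
  | .coin _ _ => coinLaw

instance (p : unitInterval) : IsProbabilityMeasure (labelLaw p) := by
  unfold labelLaw; infer_instance

instance : IsProbabilityMeasure coinLaw := by unfold coinLaw; infer_instance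

instance (p : unitInterval) (j : SeedIndex) : IsProbabilityMeasure (indexLaw p j) := by
  cases j <;> unfold indexLaw <;> infer_instance

noncomputable def configLaw (p : unitInterval) : Measure Config := Measure.infinitePi (indexLaw p)

instance (p : unitInterval) : IsProbabilityMeasure (configLaw p) := by
  unfold configLaw; infer_instance

instance (p : unitInterval) : IsProbabilityMeasure (seedLaw p) := by
  unfold seedLaw; infer_instance

theorem measurable_toSeed : Measurable Config.toSeed := by
  unfold Config.toSeed; fun_prop

/-- With a single index type, independence of events reduces to disjointness of the index sets on
which they depend. -/
theorem map_toSeed (p : unitInterval) : (configLaw p).map Config.toSeed = seedLaw p := by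
  classical
  set ofSeed : Seed → Config := fun s j => match j with
    | .hor x => s.1 x
    | .ver y => s.2.1 y
    | .coin x y => s.2.2 (x, y) with hof
  have hm : Measurable ofSeed := by
    refine measurable_pi_lambda _ fun j => ?_
    cases j <;> simp only [hof] <;> fun_prop
  have hlaw : (seedLaw p).map ofSeed = configLaw p := by
    refine Measure.eq_infinitePi _ fun s t ht => ?_
    rw [Measure.map_apply hm (.pi s.countable_toSet fun i _ => ht i)]
    have h1 : Function.Injective SeedIndex.hor := fun a b h => by simpa using h
    have h2 : Function.Injective SeedIndex.ver := fun a b h => by simpa using h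
    have h3 : Function.Injective (fun z : ℕ × ℕ => SeedIndex.coin z.1 z.2) :=
      fun a b h => by simpa [Prod.ext_iff] using h
    have hset : ofSeed ⁻¹' (s : Set SeedIndex).pi t =
        ((s.preimage SeedIndex.hor h1.injOn : Set ℕ).pi fun x => t (.hor x)) ×ˢ
        (((s.preimage SeedIndex.ver h2.injOn : Set ℕ).pi fun x => t (.ver x)) ×ˢ
        ((s.preimage _ h3.injOn : Set (ℕ × ℕ)).pi fun z => t (.coin z.1 z.2))) := by
      ext ⟨a, b, c⟩
      simp only [Set.mem_preimage, Set.mem_pi, Finset.mem_coe, Set.mem_prod, Finset.mem_preimage,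
        hof]
      refine ⟨fun h => ⟨fun x hx => h _ hx, fun x hx => h _ hx, fun x hx => h _ hx⟩, ?_⟩
      rintro ⟨ha, hb, hc⟩ (x | y | ⟨x, y⟩) hj
      · exact ha x hj
      · exact hb y hj
      · exact hc (x, y) hj
    rw [hset, seedLaw, Measure.prod_prod, Measure.prod_prod, Measure.infinitePi_pi _ fun j _ => ht _,
      Measure.infinitePi_pi _ fun j _ => ht _, Measure.infinitePi_pi _ fun j _ => ht _]
    have hdec : s = (s.preimage SeedIndex.hor h1.injOn).image SeedIndex.hor ∪
        ((s.preimage SeedIndex.ver h2.injOn).image SeedIndex.ver ∪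
        (s.preimage _ h3.injOn).image fun z : ℕ × ℕ => SeedIndex.coin z.1 z.2) := by
      ext (x | y | ⟨x, y⟩) <;> simp
    conv_rhs => rw [hdec]
    rw [Finset.prod_union, Finset.prod_union, Finset.prod_image fun a _ b _ h => h1 h,
      Finset.prod_image fun a _ b _ h => h2 h, Finset.prod_image fun a _ b _ h => h3 h]
    · rfl
    · rw [Finset.disjoint_left]; rintro (x | y | ⟨x, y⟩) <;> simp
    · rw [Finset.disjoint_left]; rintro (x | y | ⟨x, y⟩) <;> simp
  rw [← hlaw, Measure.map_map measurable_toSeed hm]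
  have : Config.toSeed ∘ ofSeed = id := rfl
  rw [this, Measure.map_id]

/-- The labelling of the quadrant produced from a configuration. -/
def fill (σ : Config) : Labelling ℕ := fillQuadrant σ.toSeed

theorem fill_hor_zero (σ : Config) (x : ℕ) : fill σ (.hor x 0) = σ (.hor x) := rfl

theorem fill_ver_zero (σ : Config) (y : ℕ) : fill σ (.ver 0 y) = σ (.ver y) := rfl

theorem fill_hor_succ (σ : Config) (x y : ℕ) : fill σ (.hor x (y + 1)) =
    fillUpper (fill σ (.hor x y)) (fill σ (.ver x y)) (σ (.coin x y)) := rfl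

theorem fill_ver_succ (σ : Config) (x y : ℕ) : fill σ (.ver (x + 1) y) =
    fillRight (fill σ (.hor x y)) (fill σ (.ver x y)) (σ (.coin x y)) := rfl

/-- The labelling `fill σ` is determined by its recursion. -/
theorem eq_fill {σ : Config} {ω : Labelling ℕ} (h0 : ∀ x, ω (.hor x 0) = σ (.hor x))
    (v0 : ∀ y, ω (.ver 0 y) = σ (.ver y))
    (hs : ∀ x y, ω (.hor x (y + 1)) =
      fillUpper (ω (.hor x y)) (ω (.ver x y)) (σ (.coin x y)))
    (vs : ∀ x y, ω (.ver (x + 1) y) =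
      fillRight (ω (.hor x y)) (ω (.ver x y)) (σ (.coin x y))) : ω = fill σ := by
  have hv : ∀ y, (∀ x, ω (.hor x y) = fill σ (.hor x y)) →
      ∀ x, ω (.ver x y) = fill σ (.ver x y) := by
    intro y hy x
    induction x with
    | zero => rw [v0, fill_ver_zero]
    | succ x ih => rw [vs, fill_ver_succ, ih, hy]
  have hh : ∀ y x, ω (.hor x y) = fill σ (.hor x y) := by
    intro y
    induction y with
    | zero => intro x; rw [h0, fill_hor_zero]
    | succ y ih => intro x; rw [hs, fill_hor_succ, ih, hv y ih]
  funext e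
  cases e with
  | hor x y => exact hh y x
  | ver x y => exact hv y (hh y) x

/-- The indices of the random bits that may influence the label of an edge. -/
def influences : Edge ℕ → Set SeedIndex
  | .hor x y => fun j => match j with
    | .hor x' => x' ≤ x
    | .ver y' => y' < y
    | .coin x' y' => x' ≤ x ∧ y' < y
  | .ver x y => fun j => match j with
    | .hor x' => x' < x
    | .ver y' => y' ≤ y
    | .coin x' y' => x' < x ∧ y' ≤ y

@[simp] theorem hor_mem_influences_hor {x y x' : ℕ} :
    SeedIndex.hor x' ∈ influences (.hor x y) ↔ x' ≤ x := Iff.rfl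
@[simp] theorem ver_mem_influences_hor {x y y' : ℕ} :
    SeedIndex.ver y' ∈ influences (.hor x y) ↔ y' < y := Iff.rfl
@[simp] theorem coin_mem_influences_hor {x y x' y' : ℕ} :
    SeedIndex.coin x' y' ∈ influences (.hor x y) ↔ x' ≤ x ∧ y' < y := Iff.rfl
@[simp] theorem hor_mem_influences_ver {x y x' : ℕ} :
    SeedIndex.hor x' ∈ influences (.ver x y) ↔ x' < x := Iff.rfl
@[simp] theorem ver_mem_influences_ver {x y y' : ℕ} :
    SeedIndex.ver y' ∈ influences (.ver x y) ↔ y' ≤ y := Iff.rfl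
@[simp] theorem coin_mem_influences_ver {x y x' y' : ℕ} :
    SeedIndex.coin x' y' ∈ influences (.ver x y) ↔ x' < x ∧ y' ≤ y := Iff.rfl

/-- Information travels only to the north and the east. In particular the coin of a square does not
influence the square's own lower and left labels. -/
theorem dependsOn_fill (e : Edge ℕ) : DependsOn (fun σ => fill σ e) (influences e) := by
  intro σ τ
  suffices H : ∀ n x y, x + y ≤ n →
      ((∀ i ∈ influences (.hor x y), σ i = τ i) → fill σ (.hor x y) = fill τ (.hor x y)) ∧
      ((∀ i ∈ influences (.ver x y), σ i = τ i) → fill σ (.ver x y) = fill τ (.ver x y)) by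
    cases e with
    | hor x y => exact (H _ x y le_rfl).1
    | ver x y => exact (H _ x y le_rfl).2
  intro n
  induction n with
  | zero =>
    intro x y hxy
    obtain ⟨rfl, rfl⟩ : x = 0 ∧ y = 0 := by omega
    exact ⟨fun h => h (.hor 0) (by simp), fun h => h (.ver 0) (by simp)⟩
  | succ n ih =>
    intro x y hxy
    constructor
    · intro h
      cases y with
      | zero => exact h (.hor x) (by simp)
      | succ y =>
        rw [fill_hor_succ, fill_hor_succ, (ih x y (by omega)).1, (ih x y (by omega)).2,
          h (.coin x y) (by simp)]
        · rintro (x' | y' | ⟨x', y'⟩) hi <;> refine h _ ?_ <;> simp at hi ⊢ <;> omega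
        · rintro (x' | y' | ⟨x', y'⟩) hi <;> refine h _ ?_ <;> simp at hi ⊢ <;> omega
    · intro h
      cases x with
      | zero => exact h (.ver y) (by simp)
      | succ x =>
        rw [fill_ver_succ, fill_ver_succ, (ih x y (by omega)).1, (ih x y (by omega)).2,
          h (.coin x y) (by simp)]
        · rintro (x' | y' | ⟨x', y'⟩) hi <;> refine h _ ?_ <;> simp at hi ⊢ <;> omega
        · rintro (x' | y' | ⟨x', y'⟩) hi <;> refine h _ ?_ <;> simp at hi ⊢ <;> omega

theorem measurable_fill_apply (e : Edge ℕ) : Measurable fun σ => fill σ e := by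
  have H : ∀ n x y, x + y ≤ n →
      (Measurable fun σ => fill σ (.hor x y)) ∧ (Measurable fun σ => fill σ (.ver x y)) := by
    intro n
    induction n with
    | zero =>
      intro x y hxy
      obtain ⟨rfl, rfl⟩ : x = 0 ∧ y = 0 := by omega
      exact ⟨measurable_pi_apply _, measurable_pi_apply _⟩
    | succ n ih =>
      intro x y hxy
      have comp : ∀ (g : Bool × Bool × Bool → Bool) x y, x + y ≤ n → Measurable fun σ =>
          g (fill σ (.hor x y), fill σ (.ver x y), σ (.coin x y)) := fun g x y h =>
        (measurable_of_countable g).comp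
          ((ih x y h).1.prodMk ((ih x y h).2.prodMk (measurable_pi_apply _)))
      constructor
      · cases y with
        | zero => exact measurable_pi_apply _
        | succ y => exact comp (fun t => fillUpper t.1 t.2.1 t.2.2) x y (by omega)
      · cases x with
        | zero => exact measurable_pi_apply _
        | succ x => exact comp (fun t => fillRight t.1 t.2.1 t.2.2) x y (by omega)
  cases e with
  | hor x y => exact (H _ x y le_rfl).1
  | ver x y => exact (H _ x y le_rfl).2

theorem measurable_fill : Measurable fill := measurable_pi_lambda _ measurable_fill_apply

theorem measurable_fillQuadrant : Measurable fillQuadrant := by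
  have h : fillQuadrant = fill ∘ fun (s : Seed) j => match j with
    | .hor x => s.1 x
    | .ver y => s.2.1 y
    | .coin x y => s.2.2 (x, y) := rfl
  rw [h]
  refine measurable_fill.comp (measurable_pi_lambda _ fun j => ?_)
  cases j <;> simp only <;> fun_prop

theorem map_fill (p : unitInterval) : (configLaw p).map fill = quadrantLaw p := by
  rw [quadrantLaw, ← map_toSeed, Measure.map_map measurable_fillQuadrant measurable_toSeed]
  rfl

theorem measurePreserving_fill (p : unitInterval) :
    MeasurePreserving fill (configLaw p) (quadrantLaw p) := ⟨measurable_fill, map_fill p⟩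

instance (p : unitInterval) : IsProbabilityMeasure (quadrantLaw p) :=
  map_fill p ▸ Measure.isProbabilityMeasure_map measurable_fill.aemeasurable

theorem labelLaw_symm_singleton (p : unitInterval) (b : Bool) :
    labelLaw (unitInterval.symm p) {b} = labelLaw p {!b} := by
  cases b <;> simp [labelLaw]

theorem coinLaw_singleton_not (b : Bool) : coinLaw {!b} = coinLaw {b} := by
  have : unitInterval.symm ⟨1 / 2, by norm_num, by norm_num⟩ =
      (⟨1 / 2, by norm_num, by norm_num⟩ : unitInterval) := by
    ext; simp [unitInterval.symm]; norm_num
  unfold coinLaw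
  rw [← labelLaw_symm_singleton, this]

/-! ### Invariance of the product law under filling -/

/-- After a square has been filled, the lower label if it agreed with the left one, and the unused
coin otherwise; it is independent of the upper and the right label. -/
def freedCoin (lower left c : Bool) : Bool := if lower = left then lower else c

/-- Replace the lower label, the left label and the coin of the square `(x₀, y₀)` by the upper
label, the right label and the freed coin. -/
def squareUpdate (x₀ y₀ : ℕ) (σ : Config) : Config
  | .hor x => if x = x₀ then fillUpper (σ (.hor x₀)) (σ (.ver y₀)) (σ (.coin x₀ y₀)) else σ (.hor x)
  | .ver y => if y = y₀ then fillRight (σ (.hor x₀)) (σ (.ver y₀)) (σ (.coin x₀ y₀)) else σ (.ver y)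
  | .coin x y => if x = x₀ ∧ y = y₀ then
      freedCoin (σ (.hor x₀)) (σ (.ver y₀)) (σ (.coin x₀ y₀)) else σ (.coin x y)

theorem squareUpdate_squareUpdate (x₀ y₀ : ℕ) (σ : Config) :
    squareUpdate x₀ y₀ (squareUpdate x₀ y₀ σ) = σ := by
  funext j
  rcases j with x | y | ⟨x, y⟩
  · by_cases h : x = x₀
    · subst h
      simp only [squareUpdate, if_true, and_self, fillUpper, fillRight, freedCoin]
      grind
    · simp [squareUpdate, h]
  · by_cases h : y = y₀
    · subst h
      simp only [squareUpdate, if_true, and_self, fillUpper, fillRight, freedCoin]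
      grind
    · simp [squareUpdate, h]
  · by_cases h : x = x₀ ∧ y = y₀
    · obtain ⟨rfl, rfl⟩ := h
      simp only [squareUpdate, if_true, and_self, fillUpper, fillRight, freedCoin]
      grind
    · simp [squareUpdate, h]

theorem measurable_squareUpdate (x₀ y₀ : ℕ) : Measurable (squareUpdate x₀ y₀) := by
  have comp : ∀ g : Bool × Bool × Bool → Bool, Measurable fun σ : Config =>
      g (σ (.hor x₀), σ (.ver y₀), σ (.coin x₀ y₀)) := fun g =>
    (measurable_of_countable g).comp (by fun_prop)
  refine measurable_pi_lambda _ fun j => ?_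
  rcases j with x | y | ⟨x, y⟩ <;> simp only [squareUpdate] <;> split_ifs
  · exact comp fun t => fillUpper t.1 t.2.1 t.2.2
  · fun_prop
  · exact comp fun t => fillRight t.1 t.2.1 t.2.2
  · fun_prop
  · exact comp fun t => freedCoin t.1 t.2.1 t.2.2
  · fun_prop

theorem configLaw_cylinder (p : unitInterval) (r : Finset SeedIndex) (v : Config) :
    configLaw p {σ | ∀ i ∈ r, σ i = v i} = ∏ i ∈ r, indexLaw p i {v i} := by
  have : {σ : Config | ∀ i ∈ r, σ i = v i} = (r : Set SeedIndex).pi fun i => {v i} := by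
    ext σ; simp [Set.mem_pi]
  rw [this, configLaw, Measure.infinitePi_pi _ fun _ _ => measurableSet_singleton _]

theorem measurePreserving_squareUpdate (p : unitInterval) (x₀ y₀ : ℕ) :
    MeasurePreserving (squareUpdate x₀ y₀) (configLaw p) (configLaw p) := by
  classical
  have hm := measurable_squareUpdate x₀ y₀
  have := Measure.isProbabilityMeasure_map (μ := configLaw p) hm.aemeasurable
  set s : Finset SeedIndex := {.hor x₀, .ver y₀, .coin x₀ y₀} with hs
  refine ⟨hm, ext_of_cylinders s fun r hr v => ?_⟩
  have h1 : SeedIndex.hor x₀ ∈ r := hr (by simp [hs])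
  have h2 : SeedIndex.ver y₀ ∈ r := hr (by simp [hs])
  have h3 : SeedIndex.coin x₀ y₀ ∈ r := hr (by simp [hs])
  have hloc : ∀ σ τ : Config, (∀ i ∈ r, σ i = τ i) →
      ∀ i ∈ r, squareUpdate x₀ y₀ σ i = squareUpdate x₀ y₀ τ i := by
    intro σ τ h i hi
    rcases i with x | y | ⟨x, y⟩ <;>
      simp only [squareUpdate, h _ h1, h _ h2, h _ h3, h _ hi]
  -- The update is an involution acting inside the coordinates of `r`, so it maps cylinders over `r`
  -- to cylinders over `r`.
  have hpre : squareUpdate x₀ y₀ ⁻¹' {σ | ∀ i ∈ r, σ i = v i} =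
      {σ | ∀ i ∈ r, σ i = squareUpdate x₀ y₀ v i} := by
    ext σ
    constructor
    · intro h i hi
      have := hloc _ _ h i hi
      rwa [squareUpdate_squareUpdate] at this
    · intro h i hi
      have := hloc _ _ h i hi
      rwa [squareUpdate_squareUpdate] at this
  have hcyl : MeasurableSet {σ : Config | ∀ i ∈ r, σ i = v i} := by
    have : {σ : Config | ∀ i ∈ r, σ i = v i} = (r : Set SeedIndex).pi fun i => {v i} := by
      ext σ; simp [Set.mem_pi]
    rw [this]
    exact .pi r.countable_toSet fun i _ => measurableSet_singleton _
  rw [Measure.map_apply hm hcyl, hpre, configLaw_cylinder, configLaw_cylinder,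
    ← Finset.prod_sdiff hr, ← Finset.prod_sdiff hr]
  congr 1
  · refine Finset.prod_congr rfl fun i hi => ?_
    have hi' : i ∉ s := (Finset.mem_sdiff.1 hi).2
    congr 2
    rcases i with x | y | ⟨x, y⟩ <;> simp [hs] at hi' <;> simp [squareUpdate]
    · exact fun h => absurd h hi'
    · exact fun h => absurd h hi'
    · exact fun h h' => absurd h' (hi' h)
  -- Only the three updated factors remain. The values change only when lower and left agree, and
  -- then both products equal p(1-p) times a fair coin weight.
  · have hprod : ∀ f : SeedIndex → ENNReal,
        ∏ i ∈ s, f i = f (.hor x₀) * (f (.ver y₀) * f (.coin x₀ y₀)) := by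
      intro f
      rw [hs, Finset.prod_insert (by simp), Finset.prod_insert (by simp), Finset.prod_singleton]
    rw [hprod, hprod]
    simp only [indexLaw, squareUpdate, if_true, and_self, labelLaw_symm_singleton]
    have hc := coinLaw_singleton_not true
    rw [Bool.not_true] at hc
    cases v (.hor x₀) <;> cases v (.ver y₀) <;> cases v (.coin x₀ y₀) <;>
      simp [fillUpper, fillRight, freedCoin, hc] <;> ring

/-- The configuration obtained by filling column `x` up to height `H x` and row `y` up to
abscissa `W y`. -/
def frontier (H W : ℕ → ℕ) (σ : Config) : Config
  | .hor x => fill σ (.hor x (H x))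
  | .ver y => fill σ (.ver (W y) y)
  -- The set of filled squares is read off from `H` alone; `W` is meant to describe the same set by
  -- rows.
  | .coin x y => if y < H x then
      freedCoin (fill σ (.hor x y)) (fill σ (.ver x y)) (σ (.coin x y)) else σ (.coin x y)

/-- The hypotheses make (x₀, y₀) the next unfilled square of both its column and its row. The
frontier therefore carries exactly its lower label, its left label and its still unused coin. -/
theorem squareUpdate_frontier {H W : ℕ → ℕ} {x₀ y₀ : ℕ} (hH : H x₀ = y₀) (hW : W y₀ = x₀)
    (σ : Config) : squareUpdate x₀ y₀ (frontier H W σ) =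
      frontier (Function.update H x₀ (y₀ + 1)) (Function.update W y₀ (x₀ + 1)) σ := by
  funext j
  rcases j with x | y | ⟨x, y⟩
  · by_cases h : x = x₀
    · subst h; simp [squareUpdate, frontier, hH, hW, fill_hor_succ]
    · simp [squareUpdate, frontier, h]
  · by_cases h : y = y₀
    · subst h; simp [squareUpdate, frontier, hH, hW, fill_ver_succ]
    · simp [squareUpdate, frontier, h]
  · by_cases h : x = x₀ ∧ y = y₀
    · obtain ⟨rfl, rfl⟩ := h; simp [squareUpdate, frontier, hH, hW]
    · simp only [squareUpdate, frontier, h, if_false]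
      by_cases hx : x = x₀
      · subst hx
        have : y ≠ y₀ := fun hy => h ⟨rfl, hy⟩
        rw [Function.update_self, hH]
        congr 1
        simp only [eq_iff_iff]
        omega
      · rw [Function.update_of_ne hx]

/-- Fill the squares of the rectangle `[0, M] × [0, N]`. -/
def fillRect (M N : ℕ) : Config → Config :=
  frontier (fun x => if x < M then N else 0) (fun y => if y < N then M else 0)

theorem measurePreserving_fillRect (p : unitInterval) (M N : ℕ) :
    MeasurePreserving (fillRect M N) (configLaw p) (configLaw p) := by
  -- The intermediate region has `N` complete rows of length `M` and the first `n` squares of the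
  -- next row.
  have step : ∀ N, MeasurePreserving (fillRect M N) (configLaw p) (configLaw p) →
      ∀ n ≤ M, MeasurePreserving (frontier
        (fun x => if x < n then N + 1 else if x < M then N else 0)
        (fun y => if y < N then M else if y = N then n else 0)) (configLaw p) (configLaw p) := by
    intro N hN n
    induction n with
    | zero =>
      intro _
      convert hN using 2
      unfold fillRect
      congr 1
      funext y; split_ifs <;> rfl
    | succ n ih =>
      intro hn
      have := (measurePreserving_squareUpdate p n N).comp (ih (by omega))
      convert this using 1
      funext σ
      rw [Function.comp_apply, squareUpdate_frontier (by simp; omega) (by simp)]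
      congr 1
      · funext x
        by_cases hx : x = n
        · subst hx; simp
        · rw [Function.update_of_ne hx]
          have : x < n + 1 ↔ x < n := by omega
          simp [this]
      · funext y
        by_cases hy : y = N
        · subst hy; simp
        · rw [Function.update_of_ne hy]; simp [hy]
  induction N with
  | zero =>
    convert MeasurePreserving.id (configLaw p) using 1
    funext σ j
    rcases j with x | y | ⟨x, y⟩ <;> simp [fillRect, frontier, fill_hor_zero, fill_ver_zero]
  | succ N ih =>
    convert step N ih M le_rfl using 2
    unfold fillRect
    congr 1
    · funext x; split_ifs <;> rfl
    · funext y
      rcases lt_trichotomy y N with h | h | h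
      · simp [h, h.trans (Nat.lt_succ_self N)]
      · simp [h]
      · simp [h.ne', not_lt_of_gt h, show ¬ y < N + 1 by omega]

/-! ### Consistency of the quadrant law -/

/-- The quadrant with corner `(M, N)`, inside the first quadrant. -/
def Edge.shiftNat (M N : ℕ) : Edge ℕ → Edge ℕ
  | .hor x y => .hor (M + x) (N + y)
  | .ver x y => .ver (M + x) (N + y)

/-- Cut out the quadrant with corner `(M, N)`. -/
def shiftQuadrant (M N : ℕ) (ω : Labelling ℕ) : Labelling ℕ := fun e => ω (e.shiftNat M N)

/-- The configuration from which the quadrant with corner `(M, N)` is filled. -/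
def shiftConfig (M N : ℕ) (σ : Config) : Config
  | .hor x => fill σ (.hor (M + x) N)
  | .ver y => fill σ (.ver M (N + y))
  | .coin x y => σ (.coin (M + x) (N + y))

theorem fill_shiftConfig (M N : ℕ) (σ : Config) :
    fill (shiftConfig M N σ) = shiftQuadrant M N (fill σ) :=
  (eq_fill (fun _ => rfl) (fun _ => rfl) (fun _ _ => rfl) fun _ _ => rfl).symm

theorem measurable_shiftQuadrant (M N : ℕ) : Measurable (shiftQuadrant M N) := by
  unfold shiftQuadrant; fun_prop

theorem measurable_shiftConfig (M N : ℕ) : Measurable (shiftConfig M N) := by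
  refine measurable_pi_lambda _ fun j => ?_
  rcases j with x | y | ⟨x, y⟩
  · exact measurable_fill_apply _
  · exact measurable_fill_apply _
  · exact measurable_pi_apply _

def SeedIndex.shift (M N : ℕ) : SeedIndex → SeedIndex
  | .hor x => .hor (M + x)
  | .ver y => .ver (N + y)
  | .coin x y => .coin (M + x) (N + y)

theorem SeedIndex.shift_injective (M N : ℕ) : Function.Injective (SeedIndex.shift M N) := by
  rintro (x | y | ⟨x, y⟩) (x' | y' | ⟨x', y'⟩) h <;> simp_all [SeedIndex.shift]

theorem measurePreserving_reindex_shift (p : unitInterval) (M N : ℕ) :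
    MeasurePreserving (fun (σ : Config) j => σ (j.shift M N)) (configLaw p) (configLaw p) := by
  have := measurePreserving_reindex (indexLaw p) (SeedIndex.shift_injective M N)
  have hlaw : (fun j => indexLaw p (j.shift M N)) = indexLaw p := by
    funext j
    cases j <;> rfl
  rwa [hlaw] at this

/-- The indices with coordinates less than `K`. -/
def seedBox (K : ℕ) : Set SeedIndex
  | .hor x => x < K
  | .ver y => y < K
  | .coin x y => x < K ∧ y < K

@[simp] theorem hor_mem_seedBox {K x : ℕ} : SeedIndex.hor x ∈ seedBox K ↔ x < K := Iff.rfl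
@[simp] theorem ver_mem_seedBox {K y : ℕ} : SeedIndex.ver y ∈ seedBox K ↔ y < K := Iff.rfl
@[simp] theorem coin_mem_seedBox {K x y : ℕ} :
    SeedIndex.coin x y ∈ seedBox K ↔ x < K ∧ y < K := Iff.rfl

theorem seedBox_mono : Monotone seedBox := by
  rintro K L h (x | y | ⟨x, y⟩) <;> simp <;> omega

theorem exists_subset_seedBox (r : Finset SeedIndex) : ∃ K, (r : Set SeedIndex) ⊆ seedBox K := by
  classical
  induction r using Finset.induction_on with
  | empty => exact ⟨0, by simp⟩
  | insert j r _ ih =>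
    obtain ⟨K, hK⟩ := ih
    obtain ⟨L, hL⟩ : ∃ L, j ∈ seedBox L := by
      rcases j with x | y | ⟨x, y⟩
      · exact ⟨x + 1, by simp⟩
      · exact ⟨y + 1, by simp⟩
      · exact ⟨x + y + 1, by simp⟩
    refine ⟨max K L, ?_⟩
    rw [Finset.coe_insert, Set.insert_subset_iff]
    exact ⟨seedBox_mono (le_max_right K L) hL, hK.trans (seedBox_mono (le_max_left K L))⟩

/-- Seen through finitely many coordinates, filling `N` infinite rows is the same as filling a
sufficiently wide rectangle of height `N`. -/
theorem shiftConfig_up_eq {K M N : ℕ} (hK : K ≤ M) (σ : Config) {i : SeedIndex}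
    (hi : i ∈ seedBox K) : shiftConfig 0 N σ i = fillRect M N σ (i.shift 0 N) := by
  rcases i with x | y | ⟨x, y⟩
  · have : x < M := lt_of_lt_of_le hi hK
    simp [shiftConfig, fillRect, frontier, SeedIndex.shift, this]
  · simp [shiftConfig, fillRect, frontier, SeedIndex.shift]
  · have : ¬ N + y < if x < M then N else 0 := by split_ifs <;> omega
    simp [shiftConfig, fillRect, frontier, SeedIndex.shift, this]

theorem shiftConfig_right_eq {K M N : ℕ} (hK : K ≤ N) (σ : Config) {i : SeedIndex}
    (hi : i ∈ seedBox K) : shiftConfig M 0 σ i = fillRect M N σ (i.shift M 0) := by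
  rcases i with x | y | ⟨x, y⟩
  · simp [shiftConfig, fillRect, frontier, SeedIndex.shift]
  · have : y < N := lt_of_lt_of_le hi hK
    simp [shiftConfig, fillRect, frontier, SeedIndex.shift, this]
  · simp [shiftConfig, fillRect, frontier, SeedIndex.shift]

theorem measurePreserving_shiftConfig (p : unitInterval) (M N : ℕ) :
    MeasurePreserving (shiftConfig M N) (configLaw p) (configLaw p) := by
  have hup : MeasurePreserving (shiftConfig 0 N) (configLaw p) (configLaw p) := by
    refine measurePreserving_of_locally (measurable_shiftConfig 0 N) fun r => ?_
    obtain ⟨K, hK⟩ := exists_subset_seedBox r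
    exact ⟨_, (measurePreserving_reindex_shift p 0 N).comp (measurePreserving_fillRect p K N),
      fun σ i hi => shiftConfig_up_eq le_rfl σ (hK hi)⟩
  have hright : MeasurePreserving (shiftConfig M 0) (configLaw p) (configLaw p) := by
    refine measurePreserving_of_locally (measurable_shiftConfig M 0) fun r => ?_
    obtain ⟨K, hK⟩ := exists_subset_seedBox r
    exact ⟨_, (measurePreserving_reindex_shift p M 0).comp (measurePreserving_fillRect p M K),
      fun σ i hi => shiftConfig_right_eq le_rfl σ (hK hi)⟩
  convert hright.comp hup using 1
  funext σ j
  rcases j with x | y | ⟨x, y⟩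
  · simp [shiftConfig, fill_shiftConfig, shiftQuadrant, Edge.shiftNat]
  · simp [shiftConfig, fill_shiftConfig, shiftQuadrant, Edge.shiftNat]
  · simp [shiftConfig]

/-- The law of the labelling of the quadrant is consistent. -/
theorem measurePreserving_shiftQuadrant (p : unitInterval) (M N : ℕ) :
    MeasurePreserving (shiftQuadrant M N) (quadrantLaw p) (quadrantLaw p) := by
  refine ⟨measurable_shiftQuadrant M N, ?_⟩
  rw [← map_fill, Measure.map_map (measurable_shiftQuadrant M N) measurable_fill]
  have : shiftQuadrant M N ∘ fill = fill ∘ shiftConfig M N :=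
    funext fun σ => (fill_shiftConfig M N σ).symm
  rw [this, ← Measure.map_map measurable_fill (measurable_shiftConfig M N),
    (measurePreserving_shiftConfig p M N).map_eq]

theorem map_row (p : unitInterval) (y : ℕ) :
    (quadrantLaw p).map (fun ω (x : ℕ) => ω (.hor x y)) =
      Measure.infinitePi fun _ : ℕ => labelLaw p := by
  have hk : Function.Injective SeedIndex.hor := fun a b h => by simpa using h
  have h := (measurePreserving_reindex (indexLaw p) hk).comp (measurePreserving_shiftConfig p 0 y)
  rw [← map_fill, Measure.map_map (by fun_prop) measurable_fill]
  refine Eq.trans ?_ h.map_eq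
  congr 1
  funext σ x
  simp [shiftConfig]

theorem map_column (p : unitInterval) (x : ℕ) :
    (quadrantLaw p).map (fun ω (y : ℕ) => ω (.ver x y)) =
      Measure.infinitePi fun _ : ℕ => labelLaw (unitInterval.symm p) := by
  have hk : Function.Injective SeedIndex.ver := fun a b h => by simpa using h
  have h := (measurePreserving_reindex (indexLaw p) hk).comp (measurePreserving_shiftConfig p x 0)
  rw [← map_fill, Measure.map_map (by fun_prop) measurable_fill]
  refine Eq.trans ?_ h.map_eq
  congr 1
  funext σ y
  simp [shiftConfig]

/-! ### Resampling the seeds of a box -/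

/-- The law of two independent configurations. -/
noncomputable def pairLaw (p : unitInterval) : Measure (SeedIndex × Bool → Bool) :=
  Measure.infinitePi fun j => indexLaw p j.1

instance (p : unitInterval) : IsProbabilityMeasure (pairLaw p) := by
  unfold pairLaw; infer_instance

def original (ω : SeedIndex × Bool → Bool) : Config := fun j => ω (j, true)

open Classical in
/-- The first configuration, with the bits of a box replaced by those of the second one. -/
noncomputable def resampled (K : ℕ) (ω : SeedIndex × Bool → Bool) : Config :=
  fun j => ω (j, decide (j ∉ seedBox K))

theorem measurePreserving_original (p : unitInterval) :
    MeasurePreserving original (pairLaw p) (configLaw p) :=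
  measurePreserving_reindex (fun j : SeedIndex × Bool => indexLaw p j.1)
    (k := fun j => (j, true)) fun a b h => by simpa using h

theorem measurePreserving_resampled (p : unitInterval) (K : ℕ) :
    MeasurePreserving (resampled K) (pairLaw p) (configLaw p) := by
  classical
  exact measurePreserving_reindex (fun j : SeedIndex × Bool => indexLaw p j.1)
    (k := fun j => (j, decide (j ∉ seedBox K))) fun a b h => (Prod.ext_iff.1 h).1

/-- The event that resampling the box changes the label of an edge. -/
def discrepancy (K : ℕ) (e : Edge ℕ) : Set (SeedIndex × Bool → Bool) :=
  {ω | fill (original ω) e ≠ fill (resampled K ω) e}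

theorem measurableSet_discrepancy (K : ℕ) (e : Edge ℕ) : MeasurableSet (discrepancy K e) := by
  have h : discrepancy K e = (fun ω => (fill (original ω) e, fill (resampled K ω) e)) ⁻¹'
      {t | t.1 ≠ t.2} := rfl
  rw [h]
  -- The parameter 0 is arbitrary, since only measurability is extracted.
  exact (((measurable_fill_apply e).comp (measurePreserving_original 0).measurable).prodMk
    ((measurable_fill_apply e).comp (measurePreserving_resampled 0 K).measurable))
    MeasurableSet.of_discrete

theorem map_not_coinLaw : coinLaw.map (fun b => !b) = coinLaw := by
  have hm : Measurable fun b : Bool => !b := measurable_of_countable _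
  refine Measure.ext_of_singleton fun b => ?_
  rw [Measure.map_apply hm (measurableSet_singleton b)]
  have : (fun b : Bool => !b) ⁻¹' {b} = {!b} := by ext c; cases b <;> cases c <;> simp
  rw [this, coinLaw_singleton_not]

open Classical in
/-- Flip one bit of the first configuration. -/
noncomputable def flipBit (i : SeedIndex) (ω : SeedIndex × Bool → Bool) : SeedIndex × Bool → Bool :=
  fun j => (if j = (i, true) then fun b => !b else id) (ω j)

theorem measurePreserving_flipBit (p : unitInterval) (x y : ℕ) :
    MeasurePreserving (flipBit (.coin x y)) (pairLaw p) (pairLaw p) := by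
  classical
  have hm : ∀ j : SeedIndex × Bool,
      Measurable (if j = (.coin x y, true) then fun b : Bool => !b else id) :=
    fun j => measurable_of_countable _
  refine ⟨measurable_pi_lambda _ fun j => (hm j).comp (measurable_pi_apply j), ?_⟩
  refine (Measure.infinitePi_map_pi (fun j : SeedIndex × Bool => indexLaw p j.1) hm).trans ?_
  unfold pairLaw
  congr 1
  funext j
  split_ifs with h
  · rw [h]; exact map_not_coinLaw
  · exact Measure.map_id

theorem original_flipBit_of_ne {i j : SeedIndex} (h : j ≠ i) (ω : SeedIndex × Bool → Bool) :
    original (flipBit i ω) j = original ω j := by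
  simp [original, flipBit, h]

theorem resampled_flipBit_of_ne {K : ℕ} {i j : SeedIndex} (h : j ≠ i)
    (ω : SeedIndex × Bool → Bool) : resampled K (flipBit i ω) j = resampled K ω j := by
  simp [resampled, flipBit, h]

theorem original_flipBit_self (i : SeedIndex) (ω : SeedIndex × Bool → Bool) :
    original (flipBit i ω) i = !original ω i := by
  simp [original, flipBit]

theorem resampled_eq_original {K : ℕ} {i : SeedIndex} (h : i ∉ seedBox K)
    (ω : SeedIndex × Bool → Bool) : resampled K ω i = original ω i := by
  simp [original, resampled, h]

/-- A discrepancy at the lower or the left edge of a square outside the box is passed on to the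
upper and the right edge with probability `1 / 2` each. -/
theorem two_mul_discrepancy_le (p : unitInterval) {K x y : ℕ} (hxy : K ≤ x ∨ K ≤ y)
    {g : Bool → Bool → Bool → Bool} (e : Edge ℕ)
    (he : ∀ σ, fill σ e = g (fill σ (.hor x y)) (fill σ (.ver x y)) (σ (.coin x y)))
    (hg : ∀ a b a' b' c, (g a b c ≠ g a' b' c ∨ g a b (!c) ≠ g a' b' (!c) → a ≠ a' ∨ b ≠ b') ∧
      (g a b c ≠ g a' b' c ∧ g a b (!c) ≠ g a' b' (!c) → a ≠ a' ∧ b ≠ b')) :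
    2 * (pairLaw p).real (discrepancy K e) ≤
      (pairLaw p).real (discrepancy K (.hor x y)) + (pairLaw p).real (discrepancy K (.ver x y)) := by
  -- Outside the box both configurations use the same coin, and flipping it flips it in both.
  have hbox : SeedIndex.coin x y ∉ seedBox K := by simp; omega
  set φ := flipBit (.coin x y) with hφ
  have hflip := measurePreserving_flipBit p x y
  have horig : ∀ (e : Edge ℕ) ω, SeedIndex.coin x y ∉ influences e →
      fill (original (φ ω)) e = fill (original ω) e := fun e ω h =>
    dependsOn_fill e fun i hi => original_flipBit_of_ne (by rintro rfl; exact h hi) ω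
  have hres : ∀ (e : Edge ℕ) ω, SeedIndex.coin x y ∉ influences e →
      fill (resampled K (φ ω)) e = fill (resampled K ω) e := fun e ω h =>
    dependsOn_fill e fun i hi => resampled_flipBit_of_ne (by rintro rfl; exact h hi) ω
  have h1 : SeedIndex.coin x y ∉ influences (.hor x y) := by simp
  have h2 : SeedIndex.coin x y ∉ influences (.ver x y) := by simp
  have hD : ∀ ω, ω ∈ discrepancy K e ↔
      g (fill (original ω) (.hor x y)) (fill (original ω) (.ver x y)) (original ω (.coin x y)) ≠
      g (fill (resampled K ω) (.hor x y)) (fill (resampled K ω) (.ver x y))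
        (original ω (.coin x y)) := by
    intro ω
    rw [discrepancy, Set.mem_ofPred_eq, he, he, resampled_eq_original hbox]
  have hDφ : ∀ ω, φ ω ∈ discrepancy K e ↔
      g (fill (original ω) (.hor x y)) (fill (original ω) (.ver x y)) (!original ω (.coin x y)) ≠
      g (fill (resampled K ω) (.hor x y)) (fill (resampled K ω) (.ver x y))
        (!original ω (.coin x y)) := by
    intro ω
    rw [hD, horig _ _ h1, horig _ _ h2, hres _ _ h1, hres _ _ h2, hφ, original_flipBit_self]
  have hpre : (pairLaw p).real (φ ⁻¹' discrepancy K e) = (pairLaw p).real (discrepancy K e) := by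
    rw [measureReal_def, hflip.measure_preimage (measurableSet_discrepancy K e).nullMeasurableSet,
      measureReal_def]
  -- Averaging over the flip of the coin: by `hg`, an output discrepancy for some value of the coin
  -- needs an input discrepancy, and one for both values needs two. Inclusion-exclusion on both ends
  -- turns this into the bound.
  calc 2 * (pairLaw p).real (discrepancy K e)
      = (pairLaw p).real (discrepancy K e) + (pairLaw p).real (φ ⁻¹' discrepancy K e) := by
        rw [hpre]; ring
    _ = (pairLaw p).real (discrepancy K e ∪ φ ⁻¹' discrepancy K e) +
        (pairLaw p).real (discrepancy K e ∩ φ ⁻¹' discrepancy K e) :=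
        (measureReal_union_add_inter (hflip.measurable (measurableSet_discrepancy K e))).symm
    _ ≤ (pairLaw p).real (discrepancy K (.hor x y) ∪ discrepancy K (.ver x y)) +
        (pairLaw p).real (discrepancy K (.hor x y) ∩ discrepancy K (.ver x y)) := by
        refine add_le_add (measureReal_mono ?_) (measureReal_mono ?_)
        · intro ω hω
          exact (hg _ _ _ _ _).1 (hω.imp (hD ω).1 (hDφ ω).1)
        · intro ω hω
          exact (hg _ _ _ _ _).2 (hω.imp (hD ω).1 (hDφ ω).1)
    _ = _ := measureReal_union_add_inter (measurableSet_discrepancy K _)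

theorem two_mul_discrepancy_upper_le (p : unitInterval) {K x y : ℕ} (hxy : K ≤ x ∨ K ≤ y) :
    2 * (pairLaw p).real (discrepancy K (.hor x (y + 1))) ≤
      (pairLaw p).real (discrepancy K (.hor x y)) + (pairLaw p).real (discrepancy K (.ver x y)) :=
  two_mul_discrepancy_le p hxy (g := fillUpper) _ (fun _ => fill_hor_succ _ _ _) (by decide)

theorem two_mul_discrepancy_right_le (p : unitInterval) {K x y : ℕ} (hxy : K ≤ x ∨ K ≤ y) :
    2 * (pairLaw p).real (discrepancy K (.ver (x + 1) y)) ≤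
      (pairLaw p).real (discrepancy K (.hor x y)) + (pairLaw p).real (discrepancy K (.ver x y)) :=
  two_mul_discrepancy_le p hxy (g := fillRight) _ (fun _ => fill_ver_succ _ _ _) (by decide)

theorem discrepancy_axis_hor {K x : ℕ} (h : K ≤ x) : discrepancy K (.hor x 0) = ∅ := by
  ext ω
  simp [discrepancy, fill_hor_zero,
    resampled_eq_original (show SeedIndex.hor x ∉ seedBox K by simpa using h)]

theorem discrepancy_axis_ver {K y : ℕ} (h : K ≤ y) : discrepancy K (.ver 0 y) = ∅ := by
  ext ω
  simp [discrepancy, fill_ver_zero,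
    resampled_eq_original (show SeedIndex.ver y ∉ seedBox K by simpa using h)]

/-- The probability of a discrepancy at `(x, y)` is dominated by the probability that a simple
random walk visits `(x, y)`. -/
theorem discrepancy_add_le_choose (p : unitInterval) (K : ℕ) (n x y : ℕ) (hn : x + y ≤ n) :
    (pairLaw p).real (discrepancy K (.hor x y)) + (pairLaw p).real (discrepancy K (.ver x y)) ≤
      2 * 4 ^ K * ((x + y).choose x / 2 ^ (x + y)) := by
  have base : ∀ x y, x ≤ K → y ≤ K →
      (pairLaw p).real (discrepancy K (.hor x y)) + (pairLaw p).real (discrepancy K (.ver x y)) ≤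
      2 * 4 ^ K * ((x + y).choose x / 2 ^ (x + y)) := by
    intro x y hx hy
    have h2 : (1 : ℝ) ≤ (x + y).choose x := by
      exact_mod_cast Nat.choose_pos (Nat.le_add_right x y)
    have h3 : (2 : ℝ) ^ (x + y) ≤ 4 ^ K := by
      calc (2 : ℝ) ^ (x + y) ≤ 2 ^ (2 * K) := pow_le_pow_right₀ (by norm_num) (by omega)
        _ = 4 ^ K := by rw [pow_mul]; norm_num
    -- This is where 4 ^ K comes from: a walk path to a point of [0, K]² has probability at least 4
    -- ^ (-K). The further factor 2 counts the two edges at the point.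
    have h4 : (1 : ℝ) ≤ 4 ^ K * ((x + y).choose x / 2 ^ (x + y)) := by
      rw [← mul_div_assoc, one_le_div (by positivity)]
      nlinarith [pow_pos (show (0 : ℝ) < 4 by norm_num) K]
    have h5 := measureReal_le_one (μ := pairLaw p) (s := discrepancy K (.hor x y))
    have h6 := measureReal_le_one (μ := pairLaw p) (s := discrepancy K (.ver x y))
    linarith
  induction n generalizing x y with
  | zero =>
    obtain ⟨rfl, rfl⟩ : x = 0 ∧ y = 0 := by omega
    exact base 0 0 (Nat.zero_le _) (Nat.zero_le _)
  | succ n ih =>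
    -- The closed box [0, K]² is used, although seeds are resampled only below `K`: beyond it, the
    -- preceding squares and axis labels all lie outside the resampled box.
    by_cases hK : x ≤ K ∧ y ≤ K
    · exact base x y hK.1 hK.2
    rcases x with _ | x <;> rcases y with _ | y
    · exact base 0 0 (Nat.zero_le _) (Nat.zero_le _)
    · have h1 := two_mul_discrepancy_upper_le p (K := K) (x := 0) (y := y) (by omega)
      have h2 := ih 0 y (by omega)
      rw [discrepancy_axis_ver (K := K) (y := y + 1) (by omega), measureReal_empty]
      simp only [Nat.choose_zero_right, Nat.cast_one, zero_add, pow_succ] at h2 ⊢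
      have : (2 : ℝ) * 4 ^ K * (1 / (2 ^ y * 2)) = 2 * 4 ^ K * (1 / 2 ^ y) / 2 := by
        field_simp
      linarith
    · have h1 := two_mul_discrepancy_right_le p (K := K) (x := x) (y := 0) (by omega)
      have h2 := ih x 0 (by omega)
      rw [discrepancy_axis_hor (K := K) (x := x + 1) (by omega), measureReal_empty]
      simp only [Nat.choose_self, Nat.cast_one, add_zero, pow_succ] at h2 ⊢
      have : (2 : ℝ) * 4 ^ K * (1 / (2 ^ x * 2)) = 2 * 4 ^ K * (1 / 2 ^ x) / 2 := by
        field_simp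
      linarith
    · have h1 := two_mul_discrepancy_upper_le p (K := K) (x := x + 1) (y := y) (by omega)
      have h2 := two_mul_discrepancy_right_le p (K := K) (x := x) (y := y + 1) (by omega)
      have h3 := ih (x + 1) y (by omega)
      have h4 := ih x (y + 1) (by omega)
      -- Pascal's rule matches the recursion for the walk: half the sum of the values at the left
      -- and the lower neighbour.
      have hch : ((x + 1 + (y + 1)).choose (x + 1) : ℝ) =
          (x + (y + 1)).choose x + (x + 1 + y).choose (x + 1) := by
        rw [show x + 1 + (y + 1) = (x + (y + 1)) + 1 by ring, Nat.choose_succ_succ',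
          show x + 1 + y = x + (y + 1) by ring]
        push_cast
        ring
      have hpow : (2 : ℝ) ^ (x + 1 + (y + 1)) = 2 * 2 ^ (x + (y + 1)) := by ring
      rw [show x + 1 + y = x + (y + 1) by ring] at h3 hch
      rw [hch, hpow]
      have : (2 : ℝ) * 4 ^ K * (((x + (y + 1)).choose x + (x + (y + 1)).choose (x + 1)) /
          (2 * 2 ^ (x + (y + 1)))) =
          (2 * 4 ^ K * ((x + (y + 1)).choose x / 2 ^ (x + (y + 1))) +
          2 * 4 ^ K * ((x + (y + 1)).choose (x + 1) / 2 ^ (x + (y + 1)))) / 2 := by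
        field_simp
      linarith

/-- The induction step is (2n + 1)(2n + 3) ≤ 4(n + 1)². -/
theorem centralBinom_sq_mul_le (n : ℕ) : n.centralBinom ^ 2 * (2 * n + 1) ≤ 16 ^ n := by
  induction n with
  | zero => simp
  | succ n ih =>
    have h := Nat.succ_mul_centralBinom_succ n
    have hpos : 0 < (n + 1) ^ 2 := by positivity
    refine Nat.le_of_mul_le_mul_left ?_ hpos
    calc (n + 1) ^ 2 * ((n + 1).centralBinom ^ 2 * (2 * (n + 1) + 1))
        = ((n + 1) * (n + 1).centralBinom) ^ 2 * (2 * n + 3) := by ring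
      _ = (n.centralBinom ^ 2 * (2 * n + 1)) * (4 * (2 * n + 1) * (2 * n + 3)) := by rw [h]; ring
      _ ≤ 16 ^ n * (16 * (n + 1) ^ 2) := Nat.mul_le_mul ih (by nlinarith)
      _ = (n + 1) ^ 2 * 16 ^ (n + 1) := by ring

theorem choose_sq_mul_le (n k : ℕ) : n.choose k ^ 2 * (n + 1) ≤ 4 ^ n := by
  refine (Nat.mul_le_mul_right _ (Nat.pow_le_pow_left (Nat.choose_le_middle k n) 2)).trans ?_
  obtain ⟨m, rfl | rfl⟩ := Nat.even_or_odd' n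
  · have h := centralBinom_sq_mul_le m
    rw [Nat.centralBinom] at h
    rw [Nat.mul_div_cancel_left _ two_pos, pow_mul]
    exact h
  · have h := centralBinom_sq_mul_le (m + 1)
    -- The middle entry of an odd row is half the central entry of the next row.
    have hc : (m + 1).centralBinom = 2 * (2 * m + 1).choose m := by
      rw [Nat.centralBinom, show 2 * (m + 1) = 2 * m + 1 + 1 by ring, Nat.choose_succ_succ',
        Nat.choose_symm_half]
      ring
    rw [hc] at h
    rw [show (2 * m + 1) / 2 = m by omega]
    have h16 : 16 ^ (m + 1) = 4 * 4 ^ (2 * m + 1) := by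
      rw [pow_succ 4 (2 * m), pow_mul]; norm_num [pow_succ]; ring
    rw [h16] at h
    nlinarith [Nat.zero_le ((2 * m + 1).choose m ^ 2)]

theorem choose_div_two_pow_le (n k : ℕ) :
    (n.choose k : ℝ) / 2 ^ n ≤ 1 / √(n + 1) := by
  have h : ((n.choose k : ℝ)) ^ 2 * (n + 1) ≤ (2 ^ n) ^ 2 := by
    rw [← pow_mul, mul_comm n 2, pow_mul]
    norm_num
    exact_mod_cast choose_sq_mul_le n k
  rw [div_le_div_iff₀ (by positivity) (by positivity), one_mul]
  refine (sq_le_sq₀ (by positivity) (by positivity)).1 ?_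
  rwa [mul_pow, Real.sq_sqrt (by positivity)]

def Edge.height : Edge ℕ → ℕ
  | .hor x y => x + y
  | .ver x y => x + y

theorem discrepancy_le (p : unitInterval) (K : ℕ) (e : Edge ℕ) :
    (pairLaw p).real (discrepancy K e) ≤ 2 * 4 ^ K * (1 / √(e.height + 1)) := by
  have key : ∀ x y : ℕ,
      (pairLaw p).real (discrepancy K (.hor x y)) + (pairLaw p).real (discrepancy K (.ver x y)) ≤
      2 * 4 ^ K * (1 / √((x + y : ℕ) + 1)) := fun x y =>
    (discrepancy_add_le_choose p K _ x y le_rfl).trans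
      (mul_le_mul_of_nonneg_left (choose_div_two_pow_le _ _) (by positivity))
  cases e with
  | hor x y => exact (le_add_of_nonneg_right measureReal_nonneg).trans (key x y)
  | ver x y => exact (le_add_of_nonneg_left measureReal_nonneg).trans (key x y)

/-! ### Decay of correlations in the quadrant -/

/-- The edges whose lower left endpoints have coordinates less than `K`. -/
def edgeBox (K : ℕ) : Set (Edge ℕ)
  | .hor x y => x < K ∧ y < K
  | .ver x y => x < K ∧ y < K

@[simp] theorem hor_mem_edgeBox {K x y : ℕ} : Edge.hor x y ∈ edgeBox K ↔ x < K ∧ y < K := Iff.rfl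
@[simp] theorem ver_mem_edgeBox {K x y : ℕ} : Edge.ver x y ∈ edgeBox K ↔ x < K ∧ y < K := Iff.rfl

theorem finite_edgeBox (K : ℕ) : (edgeBox K).Finite := by
  refine (((Set.finite_Iio K).prod (Set.finite_Iio K)).image (fun z => Edge.hor z.1 z.2) |>.union
    (((Set.finite_Iio K).prod (Set.finite_Iio K)).image fun z => Edge.ver z.1 z.2)).subset ?_
  rintro (⟨x, y⟩ | ⟨x, y⟩) h
  · exact Or.inl ⟨(x, y), h, rfl⟩
  · exact Or.inr ⟨(x, y), h, rfl⟩

theorem influences_subset_seedBox {K : ℕ} {e : Edge ℕ} (he : e ∈ edgeBox K) :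
    influences e ⊆ seedBox K := by
  rcases e with ⟨x, y⟩ | ⟨x, y⟩ <;> simp at he <;>
    rintro (x' | y' | ⟨x', y'⟩) h <;> simp at h ⊢ <;> omega

theorem dependsOn_fill_mem {K : ℕ} {A : Set (Labelling ℕ)} (hA : DependsOn (· ∈ A) (edgeBox K)) :
    DependsOn (fun σ => fill σ ∈ A) (seedBox K) := fun _ _ h =>
  hA fun e he => dependsOn_fill e fun i hi => h i (influences_subset_seedBox he hi)

theorem dependsOn_shiftQuadrant {K L M N : ℕ} {A : Set (Labelling ℕ)}
    (hA : DependsOn (· ∈ A) (edgeBox K)) (hM : M + K ≤ L) (hN : N + K ≤ L) :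
    DependsOn (· ∈ shiftQuadrant M N ⁻¹' A) (edgeBox L) := fun _ _ h =>
  hA fun e he => h (e.shiftNat M N) <| by
    rcases e with ⟨x, y⟩ | ⟨x, y⟩ <;> simp [Edge.shiftNat] at he ⊢ <;> omega

theorem real_preimage_shiftQuadrant (p : unitInterval) (M N : ℕ) {A : Set (Labelling ℕ)}
    (hA : MeasurableSet A) :
    (quadrantLaw p).real (shiftQuadrant M N ⁻¹' A) = (quadrantLaw p).real A :=
  (measurePreserving_shiftQuadrant p M N).measureReal_preimage hA.nullMeasurableSet

/-- Evaluate `A` on the original configuration and the shifted `B` on the resampled one: they use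
disjoint sets of bits and so are independent. The error is the probability that resampling changes
one of the edges on which the shifted `B` depends. -/
theorem abs_real_inter_shift_sub_le (p : unitInterval) (K M N : ℕ) {A B : Set (Labelling ℕ)}
    (s : Finset (Edge ℕ)) (hA : MeasurableSet A) (hB : MeasurableSet B)
    (hAK : DependsOn (· ∈ A) (edgeBox K)) (hBs : DependsOn (· ∈ B) (s : Set (Edge ℕ))) :
    |(quadrantLaw p).real (A ∩ shiftQuadrant M N ⁻¹' B) -
      (quadrantLaw p).real A * (quadrantLaw p).real B| ≤
      s.card * (2 * 4 ^ K * (1 / √((M + N : ℕ) + 1))) := by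
  classical
  set B' := shiftQuadrant M N ⁻¹' B
  have hB' : MeasurableSet B' := measurable_shiftQuadrant M N hB
  have horig := measurePreserving_original p
  have hres := measurePreserving_resampled p K
  have hfill := measurePreserving_fill p
  set E := original ⁻¹' (fill ⁻¹' A)
  set F := original ⁻¹' (fill ⁻¹' B')
  set G := resampled K ⁻¹' (fill ⁻¹' B')
  set U := ⋃ e ∈ s, discrepancy K (e.shiftNat M N)
  have hE : MeasurableSet E := horig.measurable (measurable_fill hA)
  have hG : MeasurableSet G := hres.measurable (measurable_fill hB')
  have hEG : (pairLaw p).real (E ∩ G) = (quadrantLaw p).real A * (quadrantLaw p).real B := by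
    have hind : pairLaw p (E ∩ G) = pairLaw p E * pairLaw p G := by
      refine infinitePi_inter_of_dependsOn _ hE hG
        (S := {j | j.1 ∈ seedBox K ∧ j.2 = true}) (T := {j | j.2 = decide (j.1 ∉ seedBox K)})
        (fun ω ω' h => dependsOn_fill_mem hAK fun i hi => h (i, true) ⟨hi, rfl⟩)
        (fun ω ω' h => ?_) ?_
      · have : resampled K ω = resampled K ω' := funext fun i => h _ rfl
        simp only [G, Set.mem_preimage, this]
      · rw [Set.disjoint_left]
        rintro ⟨i, b⟩ ⟨h1, h2⟩ h3
        simp only [Set.mem_ofPred_eq] at h1 h2 h3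
        rw [h2] at h3
        simp [h1] at h3
    rw [measureReal_def, hind, ENNReal.toReal_mul, ← measureReal_def, ← measureReal_def,
      horig.measureReal_preimage (measurable_fill hA).nullMeasurableSet,
      hres.measureReal_preimage (measurable_fill hB').nullMeasurableSet,
      hfill.measureReal_preimage hA.nullMeasurableSet,
      hfill.measureReal_preimage hB'.nullMeasurableSet, real_preimage_shiftQuadrant p M N hB]
  have hEF : (pairLaw p).real (E ∩ F) = (quadrantLaw p).real (A ∩ B') := by
    rw [← hfill.measureReal_preimage (hA.inter hB').nullMeasurableSet,
      ← horig.measureReal_preimage (measurable_fill (hA.inter hB')).nullMeasurableSet]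
    rfl
  have hU : (pairLaw p).real U ≤ s.card * (2 * 4 ^ K * (1 / √((M + N : ℕ) + 1))) := by
    refine (measureReal_biUnion_finset_le s _).trans ?_
    rw [← nsmul_eq_mul]
    refine Finset.sum_le_card_nsmul _ _ _ fun e _ => (discrepancy_le p K _).trans ?_
    have hh : ((M + N : ℕ) : ℝ) ≤ (e.shiftNat M N).height := by
      rw [Nat.cast_le]
      rcases e with ⟨x, y⟩ | ⟨x, y⟩ <;> simp [Edge.shiftNat, Edge.height] <;> omega
    gcongr
  have hFG : ∀ ω, ω ∉ U → (ω ∈ F ↔ ω ∈ G) := by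
    intro ω hω
    refine iff_of_eq (hBs fun e he => ?_)
    by_contra hne
    exact hω (Set.mem_biUnion he hne)
  have h1 : (pairLaw p).real (E ∩ F) ≤ (pairLaw p).real (E ∩ G) + (pairLaw p).real U := by
    refine (measureReal_mono fun ω hω => ?_).trans (measureReal_union_le _ _)
    by_cases hωU : ω ∈ U
    · exact Or.inr hωU
    · exact Or.inl ⟨hω.1, (hFG ω hωU).1 hω.2⟩
  have h2 : (pairLaw p).real (E ∩ G) ≤ (pairLaw p).real (E ∩ F) + (pairLaw p).real U := by
    refine (measureReal_mono fun ω hω => ?_).trans (measureReal_union_le _ _)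
    by_cases hωU : ω ∈ U
    · exact Or.inr hωU
    · exact Or.inl ⟨hω.1, (hFG ω hωU).2 hω.2⟩
  rw [← hEF, ← hEG, abs_le]
  constructor <;> linarith

/-- Labels far apart in the north-west and the south-east are independent. -/
theorem real_inter_shift_eq_mul (p : unitInterval) {K M N : ℕ} (hM : K ≤ M) (hN : K ≤ N)
    {A B : Set (Labelling ℕ)} (hA : MeasurableSet A) (hB : MeasurableSet B)
    (hAK : DependsOn (· ∈ A) (edgeBox K)) (hBK : DependsOn (· ∈ B) (edgeBox K)) :
    (quadrantLaw p).real (shiftQuadrant 0 N ⁻¹' A ∩ shiftQuadrant M 0 ⁻¹' B) =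
      (quadrantLaw p).real A * (quadrantLaw p).real B := by
  have hfill := measurePreserving_fill p
  have hup := measurePreserving_reindex_shift p 0 N
  have hright := measurePreserving_reindex_shift p M 0
  set E := (fun (σ : Config) j => σ (j.shift 0 N)) ⁻¹' (fill ⁻¹' A)
  set F := (fun (σ : Config) j => σ (j.shift M 0)) ⁻¹' (fill ⁻¹' B)
  have hE : MeasurableSet E := hup.measurable (measurable_fill hA)
  have hF : MeasurableSet F := hright.measurable (measurable_fill hB)
  -- The north-west and the south-east box are both filled from the single configuration left by the
  -- rectangle [0, M] × [0, N], one from indices shifted up and the other from indices shifted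
  -- right.
  have hset : fill ⁻¹' (shiftQuadrant 0 N ⁻¹' A ∩ shiftQuadrant M 0 ⁻¹' B) =
      fillRect M N ⁻¹' (E ∩ F) := by
    ext σ
    refine and_congr (iff_of_eq ?_) (iff_of_eq ?_)
    · change (shiftQuadrant 0 N (fill σ) ∈ A) = _
      rw [← fill_shiftConfig]
      exact dependsOn_fill_mem hAK fun i hi => shiftConfig_up_eq hM σ hi
    · change (shiftQuadrant M 0 (fill σ) ∈ B) = _
      rw [← fill_shiftConfig]
      exact dependsOn_fill_mem hBK fun i hi => shiftConfig_right_eq hN σ hi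
  have hind : configLaw p (E ∩ F) = configLaw p E * configLaw p F := by
    refine infinitePi_inter_of_dependsOn _ hE hF
      (S := SeedIndex.shift 0 N '' seedBox K) (T := SeedIndex.shift M 0 '' seedBox K)
      (fun σ τ h => dependsOn_fill_mem hAK fun i hi => h _ ⟨i, hi, rfl⟩)
      (fun σ τ h => dependsOn_fill_mem hBK fun i hi => h _ ⟨i, hi, rfl⟩) ?_
    rw [Set.disjoint_left]
    rintro _ ⟨i, hi, rfl⟩ ⟨j, hj, hij⟩
    rcases i with x | y | ⟨x, y⟩ <;> rcases j with x' | y' | ⟨x', y'⟩ <;>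
      simp [SeedIndex.shift] at hi hj hij <;> omega
  rw [← hfill.measureReal_preimage
      ((measurable_shiftQuadrant 0 N hA).inter (measurable_shiftQuadrant M 0 hB)).nullMeasurableSet,
    hset, (measurePreserving_fillRect p M N).measureReal_preimage (hE.inter hF).nullMeasurableSet,
    measureReal_def, hind, ENNReal.toReal_mul, ← measureReal_def, ← measureReal_def,
    hup.measureReal_preimage (measurable_fill hA).nullMeasurableSet,
    hright.measureReal_preimage (measurable_fill hB).nullMeasurableSet,
    hfill.measureReal_preimage hA.nullMeasurableSet, hfill.measureReal_preimage hB.nullMeasurableSet]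

/-- A box displaced by less than `K` stays in the box of size 2K at the corner. The bound is
symmetric in the two displacements so that their roles can be exchanged. -/
theorem abs_real_inter_shift_shift_sub_le_of_lt (p : unitInterval) {K : ℕ}
    {A B : Set (Labelling ℕ)}
    (hA : MeasurableSet A) (hB : MeasurableSet B)
    (hAK : DependsOn (· ∈ A) (edgeBox K)) (hBK : DependsOn (· ∈ B) (edgeBox K))
    {a₁ a₂ b₁ b₂ : ℕ} (h₁ : a₁ < K) (h₂ : a₂ < K) :
    |(quadrantLaw p).real (shiftQuadrant a₁ a₂ ⁻¹' A ∩ shiftQuadrant b₁ b₂ ⁻¹' B) -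
      (quadrantLaw p).real A * (quadrantLaw p).real B| ≤ (finite_edgeBox K).toFinset.card *
        (2 * 4 ^ (2 * K) * (1 / √((a₁ + a₂ + b₁ + b₂ - 2 * K : ℕ) + 1))) := by
  rw [← real_preimage_shiftQuadrant p a₁ a₂ hA]
  refine (abs_real_inter_shift_sub_le p (2 * K) b₁ b₂ (finite_edgeBox K).toFinset
    (measurable_shiftQuadrant _ _ hA) hB
    (dependsOn_shiftQuadrant hAK (by omega) (by omega)) (by simpa using hBK)).trans ?_
  have : ((a₁ + a₂ + b₁ + b₂ - 2 * K : ℕ) : ℝ) ≤ (b₁ + b₂ : ℕ) := by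
    rw [Nat.cast_le]; omega
  gcongr

theorem abs_real_inter_shift_shift_sub_le (p : unitInterval) {K : ℕ} (hK : 0 < K) {A B : Set (Labelling ℕ)}
    (hA : MeasurableSet A) (hB : MeasurableSet B)
    (hAK : DependsOn (· ∈ A) (edgeBox K)) (hBK : DependsOn (· ∈ B) (edgeBox K))
    {a₁ a₂ b₁ b₂ : ℕ} (h₁ : a₁ = 0 ∨ b₁ = 0) (h₂ : a₂ = 0 ∨ b₂ = 0) :
    |(quadrantLaw p).real (shiftQuadrant a₁ a₂ ⁻¹' A ∩ shiftQuadrant b₁ b₂ ⁻¹' B) -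
      (quadrantLaw p).real A * (quadrantLaw p).real B| ≤ (finite_edgeBox K).toFinset.card *
        (2 * 4 ^ (2 * K) * (1 / √((a₁ + a₂ + b₁ + b₂ - 2 * K : ℕ) + 1))) := by
  by_cases ha : a₁ < K ∧ a₂ < K
  · exact abs_real_inter_shift_shift_sub_le_of_lt p hA hB hAK hBK ha.1 ha.2
  by_cases hb : b₁ < K ∧ b₂ < K
  · have := abs_real_inter_shift_shift_sub_le_of_lt p hB hA hBK hAK (b₁ := a₁) (b₂ := a₂) hb.1 hb.2
    rwa [Set.inter_comm, mul_comm ((quadrantLaw p).real B),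
      show b₁ + b₂ + a₁ + a₂ = a₁ + a₂ + b₁ + b₂ by ring] at this
  -- If K ≤ a₁, then b₁ = 0, hence K ≤ b₂ and a₂ = 0; likewise if K ≤ a₂. One box is north-west of
  -- the other.
  have hcases : (a₁ = 0 ∧ K ≤ a₂ ∧ K ≤ b₁ ∧ b₂ = 0) ∨ (K ≤ a₁ ∧ a₂ = 0 ∧ b₁ = 0 ∧ K ≤ b₂) := by
    omega
  have hzero : (quadrantLaw p).real (shiftQuadrant a₁ a₂ ⁻¹' A ∩ shiftQuadrant b₁ b₂ ⁻¹' B) -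
      (quadrantLaw p).real A * (quadrantLaw p).real B = 0 := by
    rcases hcases with ⟨rfl, ha', hb', rfl⟩ | ⟨ha', rfl, rfl, hb'⟩
    · rw [real_inter_shift_eq_mul p hb' ha' hA hB hAK hBK, sub_self]
    · rw [Set.inter_comm, real_inter_shift_eq_mul p ha' hb' hB hA hBK hAK, mul_comm, sub_self]
  rw [hzero, abs_zero]
  positivity

/-! ### The measure on labellings of the plane -/

instance : Countable (Edge ℤ) := by
  have h : Function.Injective (fun e : Edge ℤ => match e with
      | .hor x y => (true, x, y)
      | .ver x y => (false, x, y)) := by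
    rintro (⟨x, y⟩ | ⟨x, y⟩) (⟨x', y'⟩ | ⟨x', y'⟩) h <;> simp_all
  exact h.countable

theorem vadd_apply (z : ℤ × ℤ) (ω : Labelling ℤ) (e : Edge ℤ) : (z +ᵥ ω) e = ω (e.shift z) := rfl

theorem measurable_vadd (z : ℤ × ℤ) : Measurable fun ω : Labelling ℤ => z +ᵥ ω :=
  measurable_pi_lambda _ fun _ => measurable_pi_apply _

theorem continuous_restrictQuadrant (z : ℤ × ℤ) : Continuous (restrictQuadrant z) :=
  continuous_pi fun _ => continuous_apply _

theorem measurable_restrictQuadrant (z : ℤ × ℤ) : Measurable (restrictQuadrant z) :=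
  measurable_pi_lambda _ fun _ => measurable_pi_apply _

theorem restrictQuadrant_vadd (w z : ℤ × ℤ) (ω : Labelling ℤ) :
    restrictQuadrant w (z +ᵥ ω) = restrictQuadrant (w + z) ω := by
  funext e
  rcases e with ⟨x, y⟩ | ⟨x, y⟩ <;>
    simp only [restrictQuadrant, vadd_apply, Edge.toPlane, Edge.shift, Prod.fst_add,
      Prod.snd_add] <;>
    congr 2 <;> ring

theorem restrictQuadrant_add (z : ℤ × ℤ) (M N : ℕ) (ω : Labelling ℤ) :
    restrictQuadrant (z.1 + M, z.2 + N) ω = shiftQuadrant M N (restrictQuadrant z ω) := by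
  funext e
  rcases e with ⟨x, y⟩ | ⟨x, y⟩ <;>
    simp only [restrictQuadrant, shiftQuadrant, Edge.toPlane, Edge.shiftNat, Nat.cast_add] <;>
    congr 2 <;> ring

/-- A labelling of the plane that agrees with a given one in the quadrant with corner `c`. -/
def extendPlane (c : ℤ × ℤ) (η : Labelling ℕ) : Labelling ℤ
  | .hor x y => η (.hor (x - c.1).toNat (y - c.2).toNat)
  | .ver x y => η (.ver (x - c.1).toNat (y - c.2).toNat)

theorem measurable_extendPlane (c : ℤ × ℤ) : Measurable (extendPlane c) := by
  refine measurable_pi_lambda _ fun e => ?_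
  cases e <;> exact measurable_pi_apply _

theorem restrictQuadrant_extendPlane (c : ℤ × ℤ) (M N : ℕ) (η : Labelling ℕ) :
    restrictQuadrant (c.1 + M, c.2 + N) (extendPlane c η) = shiftQuadrant M N η := by
  have h1 : ∀ x : ℕ, (c.1 + (M : ℤ) + x - c.1).toNat = M + x := by omega
  have h2 : ∀ y : ℕ, (c.2 + (N : ℤ) + y - c.2).toNat = N + y := by omega
  funext e
  rcases e with ⟨x, y⟩ | ⟨x, y⟩ <;>
    simp [restrictQuadrant, extendPlane, Edge.toPlane, shiftQuadrant, Edge.shiftNat, h1, h2]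

/-- The edges of the plane whose lower left endpoints have coordinates in `[-k, k)`. -/
def planeBox (k : ℕ) : Set (Edge ℤ)
  | .hor x y => (-k ≤ x ∧ x < k) ∧ -k ≤ y ∧ y < k
  | .ver x y => (-k ≤ x ∧ x < k) ∧ -k ≤ y ∧ y < k

@[simp] theorem hor_mem_planeBox {k : ℕ} {x y : ℤ} :
    Edge.hor x y ∈ planeBox k ↔ (-k ≤ x ∧ x < k) ∧ -k ≤ y ∧ y < k := Iff.rfl
@[simp] theorem ver_mem_planeBox {k : ℕ} {x y : ℤ} :
    Edge.ver x y ∈ planeBox k ↔ (-k ≤ x ∧ x < k) ∧ -k ≤ y ∧ y < k := Iff.rfl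

theorem planeBox_mono : Monotone planeBox := by
  rintro k l h (⟨x, y⟩ | ⟨x, y⟩) <;> simp <;> omega

theorem exists_subset_planeBox (r : Finset (Edge ℤ)) :
    ∃ k, (r : Set (Edge ℤ)) ⊆ planeBox k := by
  classical
  induction r using Finset.induction_on with
  | empty => exact ⟨0, by simp⟩
  | insert e r _ ih =>
    obtain ⟨k, hk⟩ := ih
    obtain ⟨l, hl⟩ : ∃ l, e ∈ planeBox l := by
      rcases e with ⟨x, y⟩ | ⟨x, y⟩
      · exact ⟨x.natAbs + y.natAbs + 1, by rw [hor_mem_planeBox]; omega⟩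
      · exact ⟨x.natAbs + y.natAbs + 1, by rw [ver_mem_planeBox]; omega⟩
    refine ⟨max k l, ?_⟩
    rw [Finset.coe_insert, Set.insert_subset_iff]
    exact ⟨planeBox_mono (le_max_right k l) hl, hk.trans (planeBox_mono (le_max_left k l))⟩

theorem extendPlane_restrictQuadrant {k : ℕ} {e : Edge ℤ} (he : e ∈ planeBox k)
    (ω : Labelling ℤ) : extendPlane (-k, -k) (restrictQuadrant (-k, -k) ω) e = ω e := by
  rcases e with ⟨x, y⟩ | ⟨x, y⟩ <;> simp at he <;>
    simp only [extendPlane, restrictQuadrant, Edge.toPlane] <;> congr 2 <;> omega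

theorem dependsOn_extendPlane {k : ℕ} {A : Set (Labelling ℤ)}
    (hA : DependsOn (· ∈ A) (planeBox k)) :
    DependsOn (· ∈ extendPlane (-k, -k) ⁻¹' A) (edgeBox (2 * k)) := fun _ _ h =>
  hA fun e he => by
    rcases e with ⟨x, y⟩ | ⟨x, y⟩ <;> simp at he <;> refine h _ ?_ <;> simp <;> omega

theorem preimage_restrictQuadrant_extendPlane {k : ℕ} {A : Set (Labelling ℤ)}
    (hA : DependsOn (· ∈ A) (planeBox k)) :
    restrictQuadrant (-k, -k) ⁻¹' (extendPlane (-k, -k) ⁻¹' A) = A := by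
  ext ω
  exact iff_of_eq (hA fun e he => extendPlane_restrictQuadrant he ω)

namespace IsPlaneExtension

variable {p : unitInterval} {μ ν : Measure (Labelling ℤ)}

theorem measurePreserving (h : IsPlaneExtension p μ) (z : ℤ × ℤ) :
    MeasurePreserving (restrictQuadrant z) μ (quadrantLaw p) :=
  ⟨measurable_restrictQuadrant z, h z⟩

theorem isProbabilityMeasure (h : IsPlaneExtension p μ) : IsProbabilityMeasure μ := by
  constructor
  have h0 := (h.measurePreserving 0).measure_preimage (s := Set.univ) .univ
  rw [Set.preimage_univ] at h0
  exact h0.trans measure_univ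

theorem unique (hμ : IsPlaneExtension p μ) (hν : IsPlaneExtension p ν) : μ = ν := by
  have := hμ.isProbabilityMeasure
  have := hν.isProbabilityMeasure
  refine ext_of_map_restrict fun r => ?_
  obtain ⟨k, hk⟩ := exists_subset_planeBox r
  have hr : (r.restrict : Labelling ℤ → r → Bool) =
      (r.restrict ∘ extendPlane (-k, -k)) ∘ restrictQuadrant (-k, -k) := by
    funext ω e
    exact (extendPlane_restrictQuadrant (hk e.2) ω).symm
  have hm : Measurable ((r.restrict : Labelling ℤ → r → Bool) ∘ extendPlane (-k, -k)) :=
    (Finset.measurable_restrict r).comp (measurable_extendPlane _)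
  rw [hr, ← Measure.map_map hm (measurable_restrictQuadrant _),
    ← Measure.map_map hm (measurable_restrictQuadrant _), hμ, hν]

theorem map_vadd (h : IsPlaneExtension p μ) (z : ℤ × ℤ) :
    IsPlaneExtension p (μ.map fun ω => z +ᵥ ω) := by
  intro w
  rw [Measure.map_map (measurable_restrictQuadrant w) (measurable_vadd z), ← h (w + z)]
  congr 1
  funext ω
  exact restrictQuadrant_vadd w z ω

theorem measurePreserving_vadd (h : IsPlaneExtension p μ) (z : ℤ × ℤ) :
    MeasurePreserving (fun ω : Labelling ℤ => z +ᵥ ω) μ μ :=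
  ⟨measurable_vadd z, (h.map_vadd z).unique h⟩

theorem vaddInvariantMeasure (h : IsPlaneExtension p μ) :
    VAddInvariantMeasure (ℤ × ℤ) (Labelling ℤ) μ :=
  ⟨fun z _ hs => (h.measurePreserving_vadd z).measure_preimage hs.nullMeasurableSet⟩

theorem ae_isCocycle (h : IsPlaneExtension p μ) : ∀ᵐ ω ∂μ, IsCocycle ω := by
  have hq : ∀ᵐ η ∂(quadrantLaw p),
      SquareCocycle (η (.hor 0 0)) (η (.ver 0 0)) (η (.hor 0 1)) (η (.ver 1 0)) := by
    rw [← map_fill]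
    refine (ae_map_iff measurable_fill.aemeasurable ?_).2 (.of_forall fun σ => ?_)
    · have hm : Measurable fun η : Labelling ℕ =>
          (η (.hor 0 0), η (.ver 0 0), η (.hor 0 1), η (.ver 1 0)) := by fun_prop
      exact hm (MeasurableSet.of_discrete
        (s := {t : Bool × Bool × Bool × Bool | SquareCocycle t.1 t.2.1 t.2.2.1 t.2.2.2}))
    · exact (squareCocycle_iff _ _ _ _).2
        ⟨σ (.coin 0 0), fill_hor_succ σ 0 0, fill_ver_succ σ 0 0⟩
  simp only [IsCocycle, ae_all_iff]
  intro x y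
  have := ae_of_ae_map (measurable_restrictQuadrant (x, y)).aemeasurable ((h (x, y)).symm ▸ hq)
  simpa [restrictQuadrant, Edge.toPlane] using this

end IsPlaneExtension

theorem exists_isPlaneExtension (p : unitInterval) :
    ∃ μ : Measure (Labelling ℤ), IsPlaneExtension p μ := by
  set ν : ℕ → ProbabilityMeasure (Labelling ℤ) := fun n =>
    ⟨(quadrantLaw p).map (extendPlane (-n, -n)),
      Measure.isProbabilityMeasure_map (measurable_extendPlane _).aemeasurable⟩ with hν
  -- The probability measures on the compact space of labellings form a compact space, so the
  -- sequence converges along an ultrafilter. Labels of `extendPlane` outside its quadrant are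
  -- arbitrary and disappear in the limit.
  obtain ⟨μ, -, hμ⟩ := isCompact_univ.ultrafilter_le_nhds ((hyperfilter ℕ).map ν) (by simp)
  have hlim : Tendsto ν (hyperfilter ℕ) (𝓝 μ) := hμ
  refine ⟨μ, fun z => ?_⟩
  have := Measure.isProbabilityMeasure_map (μ := (μ : Measure (Labelling ℤ)))
    (measurable_restrictQuadrant z).aemeasurable
  refine ext_of_cylinders ∅ fun r _ v => ?_
  set C : Set (Labelling ℕ) := {η | ∀ e ∈ r, η e = v e}
  have hCeq : C = (r : Set (Edge ℕ)).pi fun e => {v e} := by ext; simp [C, Set.mem_pi]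
  have hCm : MeasurableSet C := by
    rw [hCeq]
    exact .pi r.countable_toSet fun _ _ => measurableSet_singleton _
  have hCc : IsClopen C := by
    rw [hCeq]
    exact ⟨isClosed_set_pi fun _ _ => isClosed_discrete _,
      isOpen_set_pi r.finite_toSet fun _ _ => isOpen_discrete _⟩
  have hconv := ProbabilityMeasure.tendsto_measure_of_null_frontier_of_tendsto' hlim
    (E := restrictQuadrant z ⁻¹' C) (by
      rw [(hCc.preimage (continuous_restrictQuadrant z)).frontier_eq, measure_empty])
  have hconst : Tendsto (fun n => (ν n : Measure (Labelling ℤ)) (restrictQuadrant z ⁻¹' C))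
      (hyperfilter ℕ) (𝓝 (quadrantLaw p C)) := by
    refine Tendsto.congr' ?_ tendsto_const_nhds
    refine Nat.hyperfilter_le_atTop ?_
    -- From this `n` on, `z` lies in the quadrant with corner (-n, -n), and consistency gives the
    -- exact law.
    filter_upwards [eventually_ge_atTop (z.1.natAbs + z.2.natAbs)] with n hn
    change _ = (quadrantLaw p).map (extendPlane (-n, -n)) _
    rw [Measure.map_apply (measurable_extendPlane _) (measurable_restrictQuadrant z hCm),
      ← (measurePreserving_shiftQuadrant p (z.1 + n).toNat (z.2 + n).toNat).measure_preimage
        hCm.nullMeasurableSet]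
    congr 1
    ext η
    have hz : z = ((-n : ℤ) + (z.1 + n).toNat, (-n : ℤ) + (z.2 + n).toNat) := by
      ext <;> simp <;> omega
    have := restrictQuadrant_extendPlane (-n, -n) (z.1 + n).toNat (z.2 + n).toNat η
    rw [← hz] at this
    simp only [Set.mem_preimage, this]
  rw [Measure.map_apply (measurable_restrictQuadrant z) hCm]
  exact tendsto_nhds_unique hconv hconst

/-! ### Mixing and ergodicity in the plane -/

theorem tendsto_natAbs_add_natAbs :
    Tendsto (fun z : ℤ × ℤ => z.1.natAbs + z.2.natAbs) cofinite atTop := by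
  refine tendsto_atTop.2 fun n => ?_
  rw [eventually_cofinite]
  refine (Set.finite_Icc ((-n, -n) : ℤ × ℤ) (n, n)).subset fun z hz => ?_
  have hz' : ¬ n ≤ z.1.natAbs + z.2.natAbs := hz
  simp only [Set.mem_Icc, Prod.le_def]
  omega

namespace IsPlaneExtension

variable {p : unitInterval} {μ : Measure (Labelling ℤ)}

theorem tendsto_real_inter_of_dependsOn (h : IsPlaneExtension p μ) {k : ℕ} (hk : 0 < k)
    {A B : Set (Labelling ℤ)} (hA : MeasurableSet A) (hB : MeasurableSet B)
    (hAk : DependsOn (· ∈ A) (planeBox k)) (hBk : DependsOn (· ∈ B) (planeBox k)) :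
    Tendsto (fun z : ℤ × ℤ => μ.real (A ∩ (fun ω => z +ᵥ ω) ⁻¹' B)) cofinite
      (𝓝 (μ.real A * μ.real B)) := by
  set A' := extendPlane (-k, -k) ⁻¹' A with hA'
  set B' := extendPlane (-k, -k) ⁻¹' B with hB'
  have hmA : MeasurableSet A' := measurable_extendPlane _ hA
  have hmB : MeasurableSet B' := measurable_extendPlane _ hB
  have hpA := preimage_restrictQuadrant_extendPlane hAk
  have hpB := preimage_restrictQuadrant_extendPlane hBk
  have hμA : (quadrantLaw p).real A' = μ.real A := by
    rw [← (h.measurePreserving (-k, -k)).measureReal_preimage hmA.nullMeasurableSet, hpA]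
  have hμB : (quadrantLaw p).real B' = μ.real B := by
    rw [← (h.measurePreserving (-k, -k)).measureReal_preimage hmB.nullMeasurableSet, hpB]
  have hinter : ∀ z : ℤ × ℤ, μ.real (A ∩ (fun ω => z +ᵥ ω) ⁻¹' B) =
      (quadrantLaw p).real (shiftQuadrant (-z.1).toNat (-z.2).toNat ⁻¹' A' ∩
        shiftQuadrant z.1.toNat z.2.toNat ⁻¹' B') := by
    intro z
    -- The largest quadrant corner below both boxes: seen from it they are displaced by the negative
    -- and the positive part of `z`, so in each coordinate one displacement vanishes.
    set c : ℤ × ℤ := (-k - (-z.1).toNat, -k - (-z.2).toNat) with hc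
    rw [← (h.measurePreserving c).measureReal_preimage
      ((measurable_shiftQuadrant _ _ hmA).inter (measurable_shiftQuadrant _ _ hmB)).nullMeasurableSet]
    congr 1
    ext ω
    have h1 := restrictQuadrant_add c (-z.1).toNat (-z.2).toNat ω
    have h2 := restrictQuadrant_add c z.1.toNat z.2.toNat ω
    have e1 : (c.1 + ((-z.1).toNat : ℤ), c.2 + ((-z.2).toNat : ℤ)) = (-(k : ℤ), -(k : ℤ)) := by
      ext <;> simp [hc]
    have e2 : (c.1 + (z.1.toNat : ℤ), c.2 + (z.2.toNat : ℤ)) = (-(k : ℤ), -(k : ℤ)) + z := by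
      ext <;> simp only [hc, Prod.fst_add, Prod.snd_add] <;> omega
    rw [e1] at h1
    rw [e2, ← restrictQuadrant_vadd] at h2
    simp only [Set.preimage_inter, Set.mem_inter_iff, Set.mem_preimage, ← h1, ← h2]
    rw [← Set.mem_preimage (f := restrictQuadrant (-k, -k)), hpA,
      ← Set.mem_preimage (f := restrictQuadrant (-k, -k)) (s := B'), hpB]
  have hbound := fun z : ℤ × ℤ => abs_real_inter_shift_shift_sub_le p (K := 2 * k) (by omega)
    hmA hmB (dependsOn_extendPlane hAk) (dependsOn_extendPlane hBk)
    (a₁ := (-z.1).toNat) (a₂ := (-z.2).toNat) (b₁ := z.1.toNat) (b₂ := z.2.toNat)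
    (by omega) (by omega)
  simp only [← hinter, hμA, hμB] at hbound
  rw [tendsto_iff_norm_sub_tendsto_zero]
  refine squeeze_zero (fun _ => norm_nonneg _) hbound ?_
  have hsum : ∀ z : ℤ × ℤ, (-z.1).toNat + (-z.2).toNat + z.1.toNat + z.2.toNat =
      z.1.natAbs + z.2.natAbs := by omega
  simp only [hsum]
  have hn : Tendsto (fun n : ℕ => (1 : ℝ) / √((n - 2 * (2 * k) : ℕ) + 1)) atTop (𝓝 0) := by
    simp only [one_div]
    refine tendsto_inv_atTop_zero.comp (Real.tendsto_sqrt_atTop.comp ?_)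
    exact tendsto_atTop_add_const_right _ _
      (tendsto_natCast_atTop_atTop.comp (tendsto_sub_atTop_nat _))
  have := ((hn.comp tendsto_natAbs_add_natAbs).const_mul
    (2 * 4 ^ (2 * (2 * k)) : ℝ)).const_mul ((finite_edgeBox (2 * k)).toFinset.card : ℝ)
  simpa only [mul_zero, Function.comp_def] using this

theorem tendsto_real_inter_of_mem_measurableCylinders (h : IsPlaneExtension p μ)
    {A B : Set (Labelling ℤ)} (hA : A ∈ measurableCylinders fun _ : Edge ℤ => Bool)
    (hB : B ∈ measurableCylinders fun _ : Edge ℤ => Bool) :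
    Tendsto (fun z : ℤ × ℤ => μ.real (A ∩ (fun ω => z +ᵥ ω) ⁻¹' B)) cofinite
      (𝓝 (μ.real A * μ.real B)) := by
  have hdep : ∀ C ∈ measurableCylinders fun _ : Edge ℤ => Bool,
      MeasurableSet C ∧ ∃ k, DependsOn (· ∈ C) (planeBox k) := by
    intro C hC
    refine ⟨MeasurableSet.of_mem_measurableCylinders hC, ?_⟩
    obtain ⟨r, S, -, rfl⟩ := (mem_measurableCylinders _).1 hC
    obtain ⟨k, hk⟩ := exists_subset_planeBox r
    refine ⟨k, fun ω ω' hω => ?_⟩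
    have : r.restrict ω = r.restrict ω' := funext fun e => hω e (hk e.2)
    simp only [mem_cylinder, this]
  obtain ⟨hmA, k, hk⟩ := hdep A hA
  obtain ⟨hmB, l, hl⟩ := hdep B hB
  exact h.tendsto_real_inter_of_dependsOn (k := k + l + 1) (by omega) hmA hmB
    (hk.mono (planeBox_mono (by omega))) (hl.mono (planeBox_mono (by omega)))

theorem exists_measurableCylinders_real_symmDiff_lt [IsFiniteMeasure μ] {A : Set (Labelling ℤ)}
    (hA : MeasurableSet A) {ε : ℝ} (hε : 0 < ε) :
    ∃ A' ∈ measurableCylinders fun _ : Edge ℤ => Bool, μ.real (A ∆ A') < ε := by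
  obtain ⟨A', hA', hlt⟩ := exists_measure_symmDiff_lt_of_generateFrom_isSetRing (μ := μ)
    (isSetRing_measurableCylinders (α := fun _ : Edge ℤ => Bool))
    ⟨{Set.univ}, Set.countable_singleton _, by simpa using univ_mem_measurableCylinders (fun _ : Edge ℤ => Bool), by simp⟩
    generateFrom_measurableCylinders.symm hA (ENNReal.ofReal_pos.2 hε)
  refine ⟨A', hA', ?_⟩
  rw [symmDiff_comm]
  exact (ENNReal.lt_ofReal_iff_toReal_lt (measure_ne_top _ _)).1 hlt

theorem tendsto_real_inter (h : IsPlaneExtension p μ) {A B : Set (Labelling ℤ)}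
    (hA : MeasurableSet A) (hB : MeasurableSet B) :
    Tendsto (fun z : ℤ × ℤ => μ.real (A ∩ (fun ω => z +ᵥ ω) ⁻¹' B)) cofinite
      (𝓝 (μ.real A * μ.real B)) := by
  have := h.isProbabilityMeasure
  rw [Metric.tendsto_nhds]
  intro ε hε
  -- Two fifths for replacing both events inside the intersection, two for replacing them in the
  -- product, one for mixing of the cylinders.
  have hε' : 0 < ε / 5 := by positivity
  obtain ⟨A', hA', hAA'⟩ := exists_measurableCylinders_real_symmDiff_lt (μ := μ) hA hε'
  obtain ⟨B', hB', hBB'⟩ := exists_measurableCylinders_real_symmDiff_lt (μ := μ) hB hε'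
  have hmA' := MeasurableSet.of_mem_measurableCylinders hA'
  have hmB' := MeasurableSet.of_mem_measurableCylinders hB'
  filter_upwards [Metric.tendsto_nhds.1
    (h.tendsto_real_inter_of_mem_measurableCylinders hA' hB') _ hε'] with z hz
  set T : Labelling ℤ → Labelling ℤ := fun ω => z +ᵥ ω
  have hT : MeasurePreserving T μ μ := h.measurePreserving_vadd z
  have h1 : |μ.real (A ∩ T ⁻¹' B) - μ.real (A' ∩ T ⁻¹' B')| < ε / 5 + ε / 5 := by
    refine (abs_measureReal_sub_le_measureReal_symmDiff
      (hA.inter (hT.measurable hB)).nullMeasurableSet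
      (hmA'.inter (hT.measurable hmB')).nullMeasurableSet).trans_lt ?_
    have hsub : (A ∩ T ⁻¹' B) ∆ (A' ∩ T ⁻¹' B') ⊆ A ∆ A' ∪ T ⁻¹' (B ∆ B') := by
      intro ω
      simp only [Set.mem_symmDiff, Set.mem_inter_iff, Set.mem_union, Set.mem_preimage]
      tauto
    refine (measureReal_mono hsub).trans_lt ((measureReal_union_le _ _).trans_lt ?_)
    rw [hT.measureReal_preimage (hB.symmDiff hmB').nullMeasurableSet]
    exact add_lt_add hAA' hBB'
  have h2 := (abs_measureReal_sub_le_measureReal_symmDiff (μ := μ) hA.nullMeasurableSet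
    hmA'.nullMeasurableSet).trans_lt hAA'
  have h3 := (abs_measureReal_sub_le_measureReal_symmDiff (μ := μ) hB.nullMeasurableSet
    hmB'.nullMeasurableSet).trans_lt hBB'
  have h4 : |μ.real A' * μ.real B' - μ.real A * μ.real B| ≤ ε / 5 + ε / 5 := by
    have e : μ.real A' * μ.real B' - μ.real A * μ.real B =
        -((μ.real A - μ.real A') * μ.real B' + μ.real A * (μ.real B - μ.real B')) := by ring
    rw [e, abs_neg]
    refine (abs_add_le _ _).trans (add_le_add ?_ ?_)
    · rw [abs_mul, abs_of_nonneg (measureReal_nonneg (μ := μ) (s := B'))]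
      exact (mul_le_of_le_one_right (abs_nonneg _) measureReal_le_one).trans h2.le
    · rw [abs_mul, abs_of_nonneg (measureReal_nonneg (μ := μ) (s := A))]
      exact (mul_le_of_le_one_left (abs_nonneg _) measureReal_le_one).trans h3.le
  rw [Real.dist_eq] at hz ⊢
  calc |μ.real (A ∩ T ⁻¹' B) - μ.real A * μ.real B|
      = |(μ.real (A ∩ T ⁻¹' B) - μ.real (A' ∩ T ⁻¹' B')) +
          (μ.real (A' ∩ T ⁻¹' B') - μ.real A' * μ.real B') +
          (μ.real A' * μ.real B' - μ.real A * μ.real B)| := by congr 1; ring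
    _ ≤ _ := abs_add_three _ _ _
    _ < ε := by linarith

theorem isMixing (h : IsPlaneExtension p μ) : IsMixing μ := by
  have := h.isProbabilityMeasure
  intro A B hA hB
  rw [← ENNReal.tendsto_toReal_iff (fun _ => measure_ne_top _ _) (by finiteness),
    ENNReal.toReal_mul]
  exact h.tendsto_real_inter hA hB

theorem ergodicVAdd (h : IsPlaneExtension p μ) : ErgodicVAdd (ℤ × ℤ) (Labelling ℤ) μ := by
  have := h.isProbabilityMeasure
  have := h.vaddInvariantMeasure
  refine ⟨fun {A} hA hinv => ?_⟩
  -- By invariance the sequence in the mixing statement for `A` with itself is constantly `μ A`.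
  have hsq : μ A = μ A * μ A := by
    refine tendsto_nhds_unique (tendsto_const_nhds.congr fun z => ?_) (h.isMixing A A hA hA)
    rw [measure_congr ((ae_eq_refl A).inter (hinv z)), Set.inter_self]
  rw [eventuallyConst_set']
  rcases eq_or_ne (μ A) 0 with h0 | h0
  · exact Or.inl (ae_eq_empty.2 h0)
  · refine Or.inr ((prob_compl_eq_zero_iff hA).2 ?_ |> ae_eq_univ.2)
    have := (ENNReal.mul_right_inj h0 (measure_ne_top μ A)).1 ((mul_one _).trans hsq)
    exact this.symm

end IsPlaneExtension

end CocycleMeasure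

open MeasureTheory CocycleMeasure in
theorem lemma4p1 (p : unitInterval) (hp0 : 0 < p) (hp1 : p < 1) :
    -- In each strip of the quadrant the upper edges are i.i.d. with the law of the x-axis labels,
    -- and in each vertical strip the right edges are i.i.d. with the law of the y-axis labels.
    (∀ y : ℕ, (quadrantLaw p).map (fun ω (x : ℕ) => ω (Edge.hor x (y + 1))) =
        Measure.infinitePi fun _ : ℕ => labelLaw p) ∧
    (∀ x : ℕ, (quadrantLaw p).map (fun ω (y : ℕ) => ω (Edge.ver (x + 1) y)) =
        Measure.infinitePi fun _ : ℕ => labelLaw (unitInterval.symm p)) ∧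
    -- The procedure defines exactly one measure on labellings of the plane.
    ∃ μ : Measure (Labelling ℤ), IsProbabilityMeasure μ ∧ IsPlaneExtension p μ ∧
      (∀ μ' : Measure (Labelling ℤ), IsPlaneExtension p μ' → μ' = μ) ∧
      (∀ᵐ ω ∂μ, IsCocycle ω) ∧
      VAddInvariantMeasure (ℤ × ℤ) (Labelling ℤ) μ ∧
      IsMixing μ ∧
      ErgodicVAdd (ℤ × ℤ) (Labelling ℤ) μ := by
  obtain ⟨μ, hμ⟩ := exists_isPlaneExtension p
  exact ⟨fun y => map_row p (y + 1), fun x => map_column p (x + 1), μ, hμ.isProbabilityMeasure, hμ,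
    fun μ' hμ' => hμ'.unique hμ, hμ.ae_isCocycle, hμ.vaddInvariantMeasure, hμ.isMixing,
    hμ.ergodicVAdd⟩
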